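/- Let $U:\mathbb R\to\mathbb R$ be smooth ($C^\infty$) and let $U_-,U_+\in\mathbb R$. Assume: (H1) $U'(y)>0$ for all $y\in\mathbb R$, $\lim_{y\to\pm\infty}U(y)=U_\pm$, $\dfrac{U''}{U}\in L^\infty(\mathbb R)$, and $\dfrac{U''}{U}(y)<0$ for all $y\in\mathbb R$, where at a zero of $U$ the quotient $U''/U$ is understood through its continuous extension. (H2) The function $m=(-U''/U)^{1/2}$ satisfies: for every integer $k\ge 0$ there is $C_k>0$ with $|m^{(k)}|\le C_k\,m$ on $\mathbb R$; $m(y)\to0$ as $|y|\to\infty$; $m\in L^2(\mathbb R)$; and $\dfrac{U''}{U-U_+},\ \dfrac{U''}{U-U_-}\in L^\infty(\mathbb R)\cap L^2(\mathbb R)$. (H3) The infimum $\lambda_0$ of the spectrum of the self-adjoint operator $\mathcal L=-\partial_y^2-m^2$ on $L^2(\mathbb R)$, with domain $H^2(\mathbb R)$, satisfies $\lambda_0>-1$. Let $\alpha$ be a nonzero integer, let $\Delta_\alpha^{-1}$ be the inverse of $\Delta_\alpha=\partial_y^2-\alpha^2:H^2(\mathbb R)\to L^2(\mathbb R)$, and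 consider on the complex Hilbert space $L^2(\mathbb R)$ the bounded operators $$\Sigma=1+m\,\Delta_\alpha^{-1}\,m,\qquad S=\Sigma^{1/2},\qquad H=S\,U\,S,$$ where $m$ and $U$ act by multiplication and $S$ is the positive square root of $\Sigma$ (which is a positive operator under (H1)–(H3)). Then the spectrum of $H$ is $\sigma(H)=[U_-,U_+]$, and $H$ has no eigenvalues; in particular it has no eigenvalue embedded in $[U_-,U_+]$. -/

import Mathlib

open MeasureTheory Filter Topology
open scoped ENNReal ContDiff Laplacian FourierTransform SchwartzMap

namespace MixingLayer

/-- The complex Hilbert space `L²(ℝ)`. -/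
abbrev L2 : Type := Lp ℂ 2 (volume : Measure ℝ)

/-! ### Multiplication operators -/

open Classical in
/-- Multiplication by an essentially bounded real function `g`, as a bounded operator on `L²(ℝ)`
(set to `0` when `g` is not in `L^∞`). -/
noncomputable def mulOp (g : ℝ → ℝ) : L2 →L[ℂ] L2 :=
  if h : MemLp (fun y => (g y : ℂ)) ∞ (volume : Measure ℝ) then
    (ContinuousLinearMap.lsmul ℂ ℂ).holderL volume ∞ 2 2 (h.toLp _)
  else 0

theorem mulOp_eq_smul {g : ℝ → ℝ} (h : MemLp (fun y => (g y : ℂ)) ∞ (volume : Measure ℝ))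
    (f : L2) : mulOp g f = ((h.toLp _ : Lp ℂ ∞ (volume : Measure ℝ)) • f : L2) := by
  simp only [mulOp, dif_pos h]
  rfl

theorem mulOp_coeFn {g : ℝ → ℝ} (h : MemLp (fun y => (g y : ℂ)) ∞ (volume : Measure ℝ))
    (f : L2) : ∀ᵐ y, mulOp g f y = (g y : ℂ) * f y := by
  rw [mulOp_eq_smul h]
  filter_upwards [Lp.coeFn_lpSMul (r := 2) (h.toLp _) f, h.coeFn_toLp] with y h1 h2
  rw [h1, Pi.smul_apply', h2, smul_eq_mul]

/-! ### The Sobolev space `H²(ℝ)` and the second derivative -/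

/-- The Sobolev space `H²(ℝ)` as a subspace of `L²(ℝ)`. -/
noncomputable def sobolevH2 : Submodule ℂ L2 where
  carrier := {f | TemperedDistribution.MemSobolev 2 2 (f : 𝓢'(ℝ, ℂ))}
  add_mem' {f g} hf hg := by
    have := TemperedDistribution.MemSobolev.add hf hg
    simpa [← Lp.toTemperedDistributionCLM_apply] using this
  zero_mem' := by
    have := TemperedDistribution.memSobolev_fun_zero ℝ ℂ 2 2
    simpa only [Set.mem_ofPred_eq, ← Lp.toTemperedDistributionCLM_apply, map_zero] using this
  smul_mem' c f hf := by
    have := TemperedDistribution.MemSobolev.smul c hf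
    simpa [← Lp.toTemperedDistributionCLM_apply] using this

theorem toTemperedDistribution_injective :
    Function.Injective (fun f : L2 => (f : 𝓢'(ℝ, ℂ))) :=
  LinearMap.ker_eq_bot.mp
    (Lp.ker_toTemperedDistributionCLM_eq_bot (F := ℂ) (μ := (volume : Measure ℝ)) (p := 2))

theorem exists_secondDeriv (f : sobolevH2) :
    ∃ g : L2, (Δ ((f : L2) : 𝓢'(ℝ, ℂ)) : 𝓢'(ℝ, ℂ)) = (g : 𝓢'(ℝ, ℂ)) := by
  have h : TemperedDistribution.MemSobolev 2 2 ((f : L2) : 𝓢'(ℝ, ℂ)) := f.2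
  have h2 := h.laplacian
  rw [sub_self] at h2
  exact TemperedDistribution.memSobolev_zero_iff.mp h2

/-- The second derivative `∂_y² : H²(ℝ) → L²(ℝ)`: `∂_y² f` is the element of `L²(ℝ)` that
represents the distributional second derivative of `f`. -/
noncomputable def secondDeriv : sobolevH2 →ₗ[ℂ] L2 where
  toFun := fun f => (exists_secondDeriv f).choose
  map_add' := fun f g => by
    apply toTemperedDistribution_injective
    have hf := (exists_secondDeriv f).choose_spec
    have hg := (exists_secondDeriv g).choose_spec
    have hfg := (exists_secondDeriv (f + g)).choose_spec
    simp only [← Lp.toTemperedDistributionCLM_apply, Submodule.coe_add, map_add,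
      TemperedDistribution.laplacian_eq_fourierMultiplierCLM, smul_add] at hf hg hfg ⊢
    rw [← hf, ← hg, ← hfg]
  map_smul' := fun c f => by
    apply toTemperedDistribution_injective
    have hf := (exists_secondDeriv f).choose_spec
    have hfg := (exists_secondDeriv (c • f)).choose_spec
    simp only [← Lp.toTemperedDistributionCLM_apply, Submodule.coe_smul, map_smul,
      RingHom.id_apply,
      TemperedDistribution.laplacian_eq_fourierMultiplierCLM] at hf hfg ⊢
    rw [← hf, ← hfg, smul_comm]

theorem secondDeriv_spec (f : sobolevH2) :
    (Δ ((f : L2) : 𝓢'(ℝ, ℂ)) : 𝓢'(ℝ, ℂ)) = (secondDeriv f : L2) :=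
  (exists_secondDeriv f).choose_spec

/-! ### The operator `Δ_α⁻¹` -/

/-- The symbol of `Δ_α⁻¹ = (∂_y² - α²)⁻¹`, in the normalisation `𝓕 f ξ = ∫ e^{-2πi y ξ} f y dy`. -/
noncomputable def invSymbol (α : ℤ) (ξ : ℝ) : ℝ := -((2 * Real.pi * ξ) ^ 2 + (α : ℝ) ^ 2)⁻¹

/-- The operator `Δ_α⁻¹ = (∂_y² - α²)⁻¹` on `L²(ℝ)`, for a nonzero integer `α`, as a Fourier
multiplier. -/
noncomputable def invLaplacian (α : ℤ) : L2 →L[ℂ] L2 :=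
  ((Lp.fourierTransformₗᵢ ℝ ℂ).symm.toContinuousLinearEquiv : L2 →L[ℂ] L2) ∘L mulOp (invSymbol α) ∘L
    ((Lp.fourierTransformₗᵢ ℝ ℂ).toContinuousLinearEquiv : L2 →L[ℂ] L2)

theorem sq_add_sq_pos {α : ℤ} (hα : α ≠ 0) (ξ : ℝ) :
    0 < (2 * Real.pi * ξ) ^ 2 + (α : ℝ) ^ 2 := by
  have : (α : ℝ) ≠ 0 := by exact_mod_cast hα
  positivity

theorem one_le_sq {α : ℤ} (hα : α ≠ 0) : (1 : ℝ) ≤ (α : ℝ) ^ 2 := by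
  have : (1 : ℤ) ≤ α ^ 2 := Int.add_one_le_of_lt (by have := sq_pos_of_ne_zero hα; omega)
  exact_mod_cast this

theorem invSymbol_memLp {α : ℤ} (hα : α ≠ 0) :
    MemLp (fun ξ => (invSymbol α ξ : ℂ)) ∞ (volume : Measure ℝ) := by
  refine memLp_top_of_bound (C := 1) ?_ ?_
  · have : Measurable (invSymbol α) := by unfold invSymbol; fun_prop
    exact (Complex.measurable_ofReal.comp this).aestronglyMeasurable
  · refine Filter.Eventually.of_forall fun ξ => ?_
    rw [Complex.norm_real, invSymbol, norm_neg, norm_inv, Real.norm_eq_abs,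
      abs_of_pos (sq_add_sq_pos hα ξ)]
    apply inv_le_one_of_one_le₀
    have := one_le_sq hα
    nlinarith [sq_nonneg (2 * Real.pi * ξ)]

theorem invSymbol_temperate {α : ℤ} (hα : α ≠ 0) :
    (fun ξ => (invSymbol α ξ : ℂ)).HasTemperateGrowth := by
  have hα' : (α : ℝ) ≠ 0 := by exact_mod_cast hα
  have h1 := Function.hasTemperateGrowth_one_add_norm_sq_rpow ℝ (-1)
  have h2 : (fun ξ : ℝ => (2 * Real.pi / α) * ξ).HasTemperateGrowth := by fun_prop
  have h3 : (fun ξ : ℝ => -((α : ℝ) ^ 2)⁻¹ *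
      (1 + ‖(2 * Real.pi / α) * ξ‖ ^ 2) ^ (-1 : ℝ)).HasTemperateGrowth :=
    (Function.HasTemperateGrowth.const _).mul (h1.comp h2)
  have h4 : invSymbol α = fun ξ : ℝ => -((α : ℝ) ^ 2)⁻¹ *
      (1 + ‖(2 * Real.pi / α) * ξ‖ ^ 2) ^ (-1 : ℝ) := by
    ext ξ
    rw [Real.rpow_neg_one, Real.norm_eq_abs, sq_abs, neg_mul, ← mul_inv, invSymbol]
    congr 2
    field_simp
    ring
  rw [← h4] at h3
  exact Function.HasTemperateGrowth.comp Function.Complex.hasTemperateGrowth_ofReal h3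

theorem invLaplacian_toDistribution {α : ℤ} (hα : α ≠ 0) (f : L2) :
    (invLaplacian α f : 𝓢'(ℝ, ℂ)) =
      TemperedDistribution.fourierMultiplierCLM ℂ (fun ξ => (invSymbol α ξ : ℂ)) f := by
  rw [TemperedDistribution.fourierMultiplierCLM_apply, Lp.fourier_toTemperedDistribution_eq,
    ← Lp.toTemperedDistribution_smul_eq (r := 2) (invSymbol_temperate hα) (invSymbol_memLp hα),
    Lp.fourierInv_toTemperedDistribution_eq, ← mulOp_eq_smul]
  rfl

/-- `Δ_α⁻¹` maps `L²(ℝ)` into `H²(ℝ)`. -/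
theorem invLaplacian_mem {α : ℤ} (hα : α ≠ 0) (f : L2) : invLaplacian α f ∈ sobolevH2 := by
  change TemperedDistribution.MemSobolev 2 2 (invLaplacian α f : 𝓢'(ℝ, ℂ))
  have hb : (fun ξ : ℝ => (((1 + ‖ξ‖ ^ 2) ^ ((2 : ℝ) / 2) : ℝ) : ℂ)).HasTemperateGrowth := by
    fun_prop
  have hs := invSymbol_temperate hα
  have h0 : TemperedDistribution.MemSobolev 0 2 (f : 𝓢'(ℝ, ℂ)) :=
    TemperedDistribution.memSobolev_zero_iff.mpr ⟨f, rfl⟩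
  rw [show (2 : ℝ) = 2 + 0 by ring, ← TemperedDistribution.memSobolev_besselPotential_iff,
    invLaplacian_toDistribution hα, TemperedDistribution.besselPotential,
    TemperedDistribution.fourierMultiplierCLM_fourierMultiplierCLM_apply hs hb, mul_comm]
  refine h0.fourierMultiplierCLM_of_bounded (hb.mul hs) ⟨1, fun ξ => ?_⟩
  have hp := sq_add_sq_pos hα ξ
  have ha := one_le_sq hα
  have h3 : (1 : ℝ) ≤ (2 * Real.pi) ^ 2 := by nlinarith [Real.pi_gt_three]
  simp only [Pi.mul_apply, norm_mul, Complex.norm_real, invSymbol, norm_neg, norm_inv]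
  rw [div_self two_ne_zero, Real.rpow_one, Real.norm_eq_abs, Real.norm_eq_abs, Real.norm_eq_abs,
    abs_of_pos hp, abs_of_nonneg (by positivity), mul_inv_le_iff₀ hp, sq_abs]
  nlinarith [sq_nonneg ξ]

/-- `(∂_y² - α²) (Δ_α⁻¹ f) = f`. -/
theorem invLaplacian_spec {α : ℤ} (hα : α ≠ 0) (f : L2) :
    secondDeriv ⟨invLaplacian α f, invLaplacian_mem hα f⟩ - (α : ℂ) ^ 2 • invLaplacian α f = f := by
  apply toTemperedDistribution_injective
  have h := secondDeriv_spec ⟨invLaplacian α f, invLaplacian_mem hα f⟩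
  have hs := invSymbol_temperate hα
  have hl : (fun ξ : ℝ => ((‖ξ‖ ^ 2 : ℝ) : ℂ)).HasTemperateGrowth := by fun_prop
  simp only [← Lp.toTemperedDistributionCLM_apply, map_sub, map_smul] at h ⊢
  rw [← h]
  simp only [Lp.toTemperedDistributionCLM_apply, invLaplacian_toDistribution hα,
    TemperedDistribution.laplacian_eq_fourierMultiplierCLM]
  rw [TemperedDistribution.fourierMultiplierCLM_fourierMultiplierCLM_apply hs hl]
  have hone : (fun _ : ℝ => (1 : ℂ)).HasTemperateGrowth := Function.HasTemperateGrowth.const _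
  have key : ((2 * Real.pi) ^ 2 : ℂ) •
      ((fun ξ => (invSymbol α ξ : ℂ)) * (fun ξ : ℝ => ((‖ξ‖ ^ 2 : ℝ) : ℂ))) =
      -(fun _ : ℝ => (1 : ℂ)) - ((α : ℂ) ^ 2) • (fun ξ => (invSymbol α ξ : ℂ)) := by
    ext ξ
    have hp := (sq_add_sq_pos hα ξ).ne'
    simp only [Pi.smul_apply, Pi.mul_apply, Pi.sub_apply, Pi.neg_apply, smul_eq_mul, invSymbol,
      Real.norm_eq_abs, sq_abs]
    have : (2 * Real.pi) ^ 2 * (-((2 * Real.pi * ξ) ^ 2 + (α : ℝ) ^ 2)⁻¹ * ξ ^ 2) =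
      -1 - (α : ℝ) ^ 2 * -((2 * Real.pi * ξ) ^ 2 + (α : ℝ) ^ 2)⁻¹ := by
      field_simp
      ring
    exact_mod_cast congrArg Complex.ofReal this
  have key2 : ((2 * Real.pi) ^ 2 : ℂ) • TemperedDistribution.fourierMultiplierCLM ℂ
      ((fun ξ => (invSymbol α ξ : ℂ)) * (fun ξ : ℝ => ((‖ξ‖ ^ 2 : ℝ) : ℂ))) (f : 𝓢'(ℝ, ℂ)) =
      -(f : 𝓢'(ℝ, ℂ)) - ((α : ℂ) ^ 2) •
        TemperedDistribution.fourierMultiplierCLM ℂ (fun ξ => (invSymbol α ξ : ℂ)) (f : 𝓢'(ℝ, ℂ)) := by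
    have h1 := congrArg (fun g => TemperedDistribution.fourierMultiplierCLM ℂ g (f : 𝓢'(ℝ, ℂ))) key
    have hsm : ((α : ℂ) ^ 2 • (fun ξ => (invSymbol α ξ : ℂ))).HasTemperateGrowth :=
      (Function.HasTemperateGrowth.const _).mul hs
    beta_reduce at h1
    rw [TemperedDistribution.fourierMultiplierCLM_smul (hs.mul hl)] at h1
    refine h1.trans ?_
    rw [TemperedDistribution.fourierMultiplierCLM_apply,
      TemperedDistribution.smulLeftCLM_sub hone.neg hsm,
      TemperedDistribution.smulLeftCLM_neg hone, TemperedDistribution.smulLeftCLM_smul hs]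
    simp only [sub_apply, neg_apply, smul_apply, TemperedDistribution.smulLeftCLM_const, one_smul,
      TemperedDistribution.fourierMultiplierCLM_apply]
    rw [sub_eq_add_neg, FourierTransform.fourierInv_add, ← neg_smul, FourierTransform.fourierInv_smul]
    simp [sub_eq_add_neg]
  have h5 : (-(2 * Real.pi) ^ 2 : ℝ) • TemperedDistribution.fourierMultiplierCLM ℂ
      ((fun ξ => (invSymbol α ξ : ℂ)) * (fun ξ : ℝ => ((‖ξ‖ ^ 2 : ℝ) : ℂ))) (f : 𝓢'(ℝ, ℂ)) =
      -(((2 * Real.pi) ^ 2 : ℂ) • TemperedDistribution.fourierMultiplierCLM ℂ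
      ((fun ξ => (invSymbol α ξ : ℂ)) * (fun ξ : ℝ => ((‖ξ‖ ^ 2 : ℝ) : ℂ))) (f : 𝓢'(ℝ, ℂ))) := by
    rw [neg_smul, ← Complex.coe_smul]
    push_cast
    rfl
  rw [h5, key2]
  abel

/-! ### Spectrum of an unbounded operator, Schrödinger operators -/

/-- The resolvent set of an unbounded operator `T`: the `z` for which `T - z : D(T) → E` has a
bounded two-sided inverse `R : E → D(T)`. -/
def resolventSet {E : Type*} [NormedAddCommGroup E] [NormedSpace ℂ E] (T : E →ₗ.[ℂ] E) : Set ℂ :=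
  {z | ∃ R : E →L[ℂ] E, (∀ x, ∃ h : R x ∈ T.domain, T ⟨R x, h⟩ - z • R x = x) ∧
    ∀ x : T.domain, R (T x - z • (x : E)) = x}

/-- The spectrum of an unbounded operator: the complement of its resolvent set. -/
def unboundedSpectrum {E : Type*} [NormedAddCommGroup E] [NormedSpace ℂ E] (T : E →ₗ.[ℂ] E) :
    Set ℂ :=
  (resolventSet T)ᶜ

/-- The Schrödinger operator `-∂_y² + V` on `L²(ℝ)` with domain `H²(ℝ)`, for a bounded real
potential `V`. -/
noncomputable def schrodinger (V : ℝ → ℝ) : L2 →ₗ.[ℂ] L2 where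
  domain := sobolevH2
  toFun := (mulOp V : L2 →ₗ[ℂ] L2) ∘ₗ sobolevH2.subtype - secondDeriv

/-! ### The shear profile and its hypotheses -/

/-- The function `U'' / U`, extended by continuity across the zeros of `U`. (If `U' > 0` and `U'' / U`
is essentially bounded, `U` has at most one zero `y₀`, and there `U''(y₀) = 0` and the limit of
`U'' / U` exists.) -/
noncomputable def quotU (U : ℝ → ℝ) : ℝ → ℝ :=
  extendFrom {y | U y ≠ 0} (fun y => iteratedDeriv 2 U y / U y)

/-- The function `m = (-U'' / U)^{1/2}`. -/
noncomputable def m (U : ℝ → ℝ) (y : ℝ) : ℝ := Real.sqrt (-quotU U y)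

/-- Hypothesis (H1) on a smooth profile `U` with limits `Um` at `-∞` and `Up` at `+∞`. -/
structure H1 (U : ℝ → ℝ) (Um Up : ℝ) : Prop where
  smooth : ContDiff ℝ ∞ U
  deriv_pos : ∀ y, 0 < deriv U y
  tendsto_bot : Tendsto U atBot (𝓝 Um)
  tendsto_top : Tendsto U atTop (𝓝 Up)
  quot_bounded : MemLp (fun y => iteratedDeriv 2 U y / U y) ∞ (volume : Measure ℝ)
  quot_neg : ∀ y, quotU U y < 0

/-- Hypothesis (H2). -/
structure H2 (U : ℝ → ℝ) (Um Up : ℝ) : Prop where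
  deriv_le : ∀ k : ℕ, ∃ C > 0, ∀ y, |iteratedDeriv k (m U) y| ≤ C * m U y
  tendsto_zero : Tendsto (m U) (cocompact ℝ) (𝓝 0)
  memLp_two : MemLp (m U) 2 (volume : Measure ℝ)
  quot_minus_bounded : MemLp (fun y => iteratedDeriv 2 U y / (U y - Um)) ∞ (volume : Measure ℝ)
  quot_minus_memLp : MemLp (fun y => iteratedDeriv 2 U y / (U y - Um)) 2 (volume : Measure ℝ)
  quot_plus_bounded : MemLp (fun y => iteratedDeriv 2 U y / (U y - Up)) ∞ (volume : Measure ℝ)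
  quot_plus_memLp : MemLp (fun y => iteratedDeriv 2 U y / (U y - Up)) 2 (volume : Measure ℝ)

/-- Hypothesis (H3): the infimum `lam` of the spectrum of `-∂_y² - m²` is larger than `-1`. -/
def H3 (U : ℝ → ℝ) : Prop :=
  ∃ lam : ℝ, IsGLB {x : ℝ | (x : ℂ) ∈ unboundedSpectrum (schrodinger (fun y => -(m U y) ^ 2))} lam ∧
    -1 < lam

/-! ### The operator `H` -/

/-- `Σ = 1 + m Δ_α⁻¹ m`. -/
noncomputable def opSigma (U : ℝ → ℝ) (α : ℤ) : L2 →L[ℂ] L2 :=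
  1 + mulOp (m U) * invLaplacian α * mulOp (m U)

/-- The positive square root of a bounded operator on a complex Hilbert space, through the
continuous functional calculus. -/
noncomputable def posSqrt {E : Type*} [NormedAddCommGroup E] [InnerProductSpace ℂ E]
    [CompleteSpace E] (T : E →L[ℂ] E) : E →L[ℂ] E :=
  CFC.sqrt T

/-- `S = Σ^{1/2}`, the positive square root. -/
noncomputable def opS (U : ℝ → ℝ) (α : ℤ) : L2 →L[ℂ] L2 := posSqrt (opSigma U α)

/-- `H = S U S`. -/
noncomputable def opH (U : ℝ → ℝ) (α : ℤ) : L2 →L[ℂ] L2 := opS U α * mulOp U * opS U α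

end MixingLayer

/-!
Write `A_s = -∂_y² + s`, so that `Δ_α⁻¹ = -A_s⁻¹` and `Σ = 1 - B_s` with `s = α² ≥ 1` and
`B_s = m A_s⁻¹ m`, a nonnegative bounded operator.

*Positivity of `Σ`.* By the Birman–Schwinger principle (`isUnit_one_sub_birmanSchwinger`),
`1 - B_s` is invertible whenever `-s` is in the resolvent set of `-∂_y² - m²`, hence for all
`s ≥ 1`. The norm of `B_s` belongs to its spectrum, so it is never equal to `1`; being continuous
in `s` and small for large `s`, it is less than `1` (`norm_birmanSchwinger_lt_one`). Thus
`0 ≤ Σ ≤ 1`, and `Σ` and `S` are invertible.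

*Spectrum.* A profile of constant sign would be concave or convex on all of `ℝ`, which an
increasing function with finite limits cannot be, so `U₋ < 0 < U₊`. Together with `S² = Σ ≤ 1`
this gives `U₋ ≤ S U S ≤ U₊` (`spectrum_opH_subset`). Conversely `H` is similar to
`Σ U = U - m A_s⁻¹ m U`, and the indicators of shrinking intervals at `z` are approximate
eigenvectors of this operator for the value `U z`, because `A_s⁻¹` is bounded from `L¹` to `L²`
(`mem_spectrum_opH`).

*Eigenvalues.* An eigenvector of `H` for `c ∈ [U₋, U₊]` gives `g ≠ 0` with `Σ U g = c g`. If
`c = 0`, injectivity of `Σ` gives `U g = 0`. Otherwise `φ = A_s⁻¹ m U g` satisfies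
`(U - c) g = m φ` and the Rayleigh equation `(U - c) (φ'' - α² φ) = U'' φ`. On the Fourier side
one sees that `φ` is `C¹` and vanishes at infinity with `φ'`
(`exists_regular_resolventLaplacian`), and square integrability of `g` forces `φ = 0` where
`U = c` (`H1.eq_zero_of_critical`). The quantity `W = φ φ' - U' φ² / (U - c)` has derivative
`α² φ² + (φ' - U' φ / (U - c))² ≥ 0`, and it tends to zero at `±∞` and at the critical point, so
`φ = 0` (`rayleigh_eq_zero`). At `±∞` this uses that `U' / (U - c)` is bounded, also when `c` is
one of `U₋`, `U₊`; there it follows from `|U''| ≤ C |U - c|` (`neg_deriv_le_of_tendsto_zero`).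
-/

namespace MixingLayer

/-! ### Algebra of multiplication operators -/

/-- Essential boundedness of a real function, in the form in which `mulOp` asks for it. -/
abbrev EssBounded (g : ℝ → ℝ) : Prop := MemLp (fun y => (g y : ℂ)) ∞ (volume : Measure ℝ)

theorem mulOp_ext {g : ℝ → ℝ} (hg : EssBounded g) {T : L2 →L[ℂ] L2}
    (h : ∀ f : L2, ∀ᵐ y, T f y = (g y : ℂ) * f y) : mulOp g = T := by
  ext1 f
  apply Lp.ext
  filter_upwards [mulOp_coeFn hg f, h f] with y h1 h2
  rw [h1, h2]

theorem EssBounded.mul {g h : ℝ → ℝ} (hg : EssBounded g) (hh : EssBounded h) :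
    EssBounded (fun y => g y * h y) := by
  have := MemLp.mul (p := ∞) (q := ∞) (r := ∞) hh hg
  unfold EssBounded
  convert! this using 2
  simp

theorem EssBounded.sub {g h : ℝ → ℝ} (hg : EssBounded g) (hh : EssBounded h) :
    EssBounded (fun y => g y - h y) := by
  have := MemLp.sub hg hh
  unfold EssBounded
  convert! this using 2
  simp

theorem essBounded_const (c : ℝ) : EssBounded (fun _ => c) := memLp_top_const _

theorem essBounded_of_bound {g : ℝ → ℝ} (hm : AEStronglyMeasurable g volume) {C : ℝ}
    (hC : ∀ᵐ y, |g y| ≤ C) : EssBounded g := by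
  refine memLp_top_of_bound (Complex.continuous_ofReal.comp_aestronglyMeasurable hm) C ?_
  filter_upwards [hC] with y hy
  simpa using hy

theorem EssBounded.aestronglyMeasurable {g : ℝ → ℝ} (hg : EssBounded g) :
    AEStronglyMeasurable g volume := by
  have := Complex.continuous_re.comp_aestronglyMeasurable hg.1
  simpa [Function.comp_def] using this

theorem EssBounded.exists_bound {g : ℝ → ℝ} (hg : EssBounded g) :
    ∃ C : ℝ, 0 ≤ C ∧ ∀ᵐ y, |g y| ≤ C := by
  refine ⟨(eLpNormEssSup (fun y => (g y : ℂ)) volume).toReal, ENNReal.toReal_nonneg, ?_⟩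
  have hfin : eLpNormEssSup (fun y => (g y : ℂ)) volume ≠ (⊤ : ℝ≥0∞) := by
    have := hg.2
    rw [eLpNorm_exponent_top] at this
    exact this.ne
  filter_upwards [ae_le_eLpNormEssSup (f := fun y => (g y : ℂ)) (μ := volume)] with y hy
  have := ENNReal.toReal_mono hfin hy
  simpa using this

theorem mulOp_mul {g h : ℝ → ℝ} (hg : EssBounded g) (hh : EssBounded h) :
    mulOp (fun y => g y * h y) = mulOp g * mulOp h := by
  refine mulOp_ext (hg.mul hh) fun f => ?_
  rw [mul_apply_eq_comp]
  filter_upwards [mulOp_coeFn hg (mulOp h f), mulOp_coeFn hh f] with y h1 h2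
  rw [h1, h2]; push_cast; ring

theorem mulOp_sub {g h : ℝ → ℝ} (hg : EssBounded g) (hh : EssBounded h) :
    mulOp (fun y => g y - h y) = mulOp g - mulOp h := by
  refine mulOp_ext (hg.sub hh) fun f => ?_
  rw [sub_apply]
  filter_upwards [mulOp_coeFn hg f, mulOp_coeFn hh f, Lp.coeFn_sub (mulOp g f) (mulOp h f)]
    with y h1 h2 h3
  rw [h3, Pi.sub_apply, h1, h2]; push_cast; ring

theorem mulOp_const (c : ℝ) : mulOp (fun _ => c) = algebraMap ℝ (L2 →L[ℂ] L2) c := by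
  refine mulOp_ext (essBounded_const c) fun f => ?_
  have : (algebraMap ℝ (L2 →L[ℂ] L2) c) f = (c : ℂ) • f := by
    rw [Algebra.algebraMap_eq_smul_one]
    rfl
  rw [this]
  filter_upwards [Lp.coeFn_smul (c : ℂ) f] with y h1
  rw [h1]; simp

theorem mulOp_isSelfAdjoint {g : ℝ → ℝ} (hg : EssBounded g) : IsSelfAdjoint (mulOp g) := by
  rw [ContinuousLinearMap.isSelfAdjoint_iff_isSymmetric]
  intro f h
  simp only [ContinuousLinearMap.coe_coe, L2.inner_def]
  refine integral_congr_ae ?_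
  filter_upwards [mulOp_coeFn hg f, mulOp_coeFn hg h] with y h1 h2
  rw [h1, h2]
  simp
  ring

theorem mulOp_nonneg {g : ℝ → ℝ} (hg : EssBounded g) (h0 : ∀ y, 0 ≤ g y) : 0 ≤ mulOp g := by
  have hs : EssBounded (fun y => √(g y)) := by
    obtain ⟨C, hC, hb⟩ := hg.exists_bound
    refine essBounded_of_bound (C := √C)
      (Real.continuous_sqrt.comp_aestronglyMeasurable hg.aestronglyMeasurable) ?_
    filter_upwards [hb] with y hy
    rw [abs_of_nonneg (Real.sqrt_nonneg _)]
    exact Real.sqrt_le_sqrt ((le_abs_self _).trans hy)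
  have : mulOp g = star (mulOp fun y => √(g y)) * mulOp fun y => √(g y) := by
    rw [(mulOp_isSelfAdjoint hs).star_eq, ← mulOp_mul hs hs]
    congr 1; ext y; rw [Real.mul_self_sqrt (h0 y)]
  rw [this]
  exact star_mul_self_nonneg _

theorem mulOp_mono {g h : ℝ → ℝ} (hg : EssBounded g) (hh : EssBounded h) (hgh : ∀ y, g y ≤ h y) :
    mulOp g ≤ mulOp h := by
  rw [← sub_nonneg, ← mulOp_sub hh hg]
  exact mulOp_nonneg (hh.sub hg) fun y => sub_nonneg.mpr (hgh y)

theorem norm_mulOp_le {g : ℝ → ℝ} (hg : EssBounded g) {C : ℝ} (hC : 0 ≤ C) (h : ∀ y, |g y| ≤ C) :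
    ‖mulOp g‖ ≤ C := by
  refine ContinuousLinearMap.opNorm_le_bound _ hC fun f => ?_
  refine Lp.norm_le_mul_norm_of_ae_le_mul ?_
  filter_upwards [mulOp_coeFn hg f] with y h1
  rw [h1, norm_mul, Complex.norm_real]
  exact mul_le_mul_of_nonneg_right (h y) (norm_nonneg _)

/-! ### Fourier multipliers -/

/-- The Fourier multiplier with a bounded real symbol `g`. -/
noncomputable def fourierMul (g : ℝ → ℝ) : L2 →L[ℂ] L2 :=
  ((Lp.fourierTransformₗᵢ ℝ ℂ).symm.toContinuousLinearEquiv : L2 →L[ℂ] L2) ∘L mulOp g ∘L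
    ((Lp.fourierTransformₗᵢ ℝ ℂ).toContinuousLinearEquiv : L2 →L[ℂ] L2)

theorem fourierMul_apply (g : ℝ → ℝ) (f : L2) : fourierMul g f = 𝓕⁻ (mulOp g (𝓕 f)) := rfl

theorem fourierMul_sub {g h : ℝ → ℝ} (hg : EssBounded g) (hh : EssBounded h) :
    fourierMul (fun y => g y - h y) = fourierMul g - fourierMul h := by
  ext1 f
  simp only [sub_apply, fourierMul_apply, mulOp_sub hg hh]
  exact map_sub (Lp.fourierTransformₗᵢ ℝ ℂ).symm _ _

theorem fourierMul_isSelfAdjoint {g : ℝ → ℝ} (hg : EssBounded g) :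
    IsSelfAdjoint (fourierMul g) := by
  rw [ContinuousLinearMap.isSelfAdjoint_iff_isSymmetric]
  intro f h
  have hs := (ContinuousLinearMap.isSelfAdjoint_iff_isSymmetric.mp (mulOp_isSelfAdjoint hg))
    (𝓕 f) (𝓕 h)
  simp only [ContinuousLinearMap.coe_coe, fourierMul_apply] at hs ⊢
  rw [← Lp.inner_fourier_eq, ← Lp.inner_fourier_eq f]
  simpa using hs

theorem fourierMul_nonneg {g : ℝ → ℝ} (hg : EssBounded g) (h0 : ∀ y, 0 ≤ g y) :
    0 ≤ fourierMul g := by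
  rw [ContinuousLinearMap.nonneg_iff_isPositive]
  have hp := (ContinuousLinearMap.nonneg_iff_isPositive _).mp (mulOp_nonneg hg h0)
  refine ⟨(fourierMul_isSelfAdjoint hg).isSymmetric, fun f => ?_⟩
  have := hp.2 (𝓕 f)
  rw [ContinuousLinearMap.reApplyInnerSelf_apply] at this ⊢
  rw [fourierMul_apply, ← Lp.inner_fourier_eq]
  simpa using this

theorem norm_fourierMul_le {g : ℝ → ℝ} (hg : EssBounded g) {C : ℝ} (hC : 0 ≤ C)
    (h : ∀ y, |g y| ≤ C) : ‖fourierMul g‖ ≤ C := by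
  refine ContinuousLinearMap.opNorm_le_bound _ hC fun f => ?_
  rw [fourierMul_apply]
  have h1 : ‖(𝓕⁻ (mulOp g (𝓕 f)) : L2)‖ = ‖mulOp g (𝓕 f)‖ :=
    (Lp.fourierTransformₗᵢ ℝ ℂ).symm.norm_map _
  rw [h1]
  refine ((mulOp g).le_opNorm _).trans ?_
  rw [Lp.norm_fourier_eq]
  exact mul_le_mul_of_nonneg_right (norm_mulOp_le hg hC h) (norm_nonneg _)

/-! ### The resolvent of `-∂_y²` -/

/-- The symbol of `(-∂_y² + s)⁻¹`. -/
noncomputable def resolventSymbol (s ξ : ℝ) : ℝ := ((2 * Real.pi * ξ) ^ 2 + s)⁻¹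

theorem resolventSymbol_nonneg {s : ℝ} (hs : 1 ≤ s) (ξ : ℝ) : 0 ≤ resolventSymbol s ξ := by
  unfold resolventSymbol; positivity

theorem resolventSymbol_le {s : ℝ} (hs : 1 ≤ s) (ξ : ℝ) : |resolventSymbol s ξ| ≤ s⁻¹ := by
  rw [abs_of_nonneg (resolventSymbol_nonneg hs ξ)]
  exact inv_anti₀ (by linarith) (by nlinarith [sq_nonneg (2 * Real.pi * ξ)])

theorem resolventSymbol_essBounded {s : ℝ} (hs : 1 ≤ s) : EssBounded (resolventSymbol s) := by
  refine essBounded_of_bound (C := s⁻¹) ?_ (ae_of_all _ (resolventSymbol_le hs))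
  have : Measurable (resolventSymbol s) := by unfold resolventSymbol; fun_prop
  exact this.aestronglyMeasurable

theorem resolventSymbol_sub_le {s t : ℝ} (hs : 1 ≤ s) (ht : 1 ≤ t) (ξ : ℝ) :
    |resolventSymbol s ξ - resolventSymbol t ξ| ≤ |s - t| := by
  have h0 := sq_nonneg (2 * Real.pi * ξ)
  have hs' : (1 : ℝ) ≤ (2 * Real.pi * ξ) ^ 2 + s := by linarith
  have ht' : (1 : ℝ) ≤ (2 * Real.pi * ξ) ^ 2 + t := by linarith
  unfold resolventSymbol
  rw [inv_sub_inv (by positivity) (by positivity), abs_div, add_sub_add_left_eq_sub,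
    abs_sub_comm t s]
  refine div_le_self (abs_nonneg _) ?_
  rw [abs_of_pos (by positivity)]
  nlinarith

theorem resolventSymbol_temperate {s : ℝ} (hs : 1 ≤ s) :
    (fun ξ => (resolventSymbol s ξ : ℂ)).HasTemperateGrowth := by
  have h1 := Function.hasTemperateGrowth_one_add_norm_sq_rpow ℝ (-1)
  have h2 : (fun ξ : ℝ => (2 * Real.pi / √s) * ξ).HasTemperateGrowth := by fun_prop
  have h3 : (fun ξ : ℝ => s⁻¹ *
      (1 + ‖(2 * Real.pi / √s) * ξ‖ ^ 2) ^ (-1 : ℝ)).HasTemperateGrowth :=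
    (Function.HasTemperateGrowth.const _).mul (h1.comp h2)
  have h4 : resolventSymbol s = fun ξ : ℝ => s⁻¹ *
      (1 + ‖(2 * Real.pi / √s) * ξ‖ ^ 2) ^ (-1 : ℝ) := by
    ext ξ
    rw [Real.rpow_neg_one, Real.norm_eq_abs, sq_abs, ← mul_inv, resolventSymbol]
    congr 1
    have hq : (2 * Real.pi / √s * ξ) ^ 2 = (2 * Real.pi * ξ) ^ 2 / s := by
      rw [div_mul_eq_mul_div, div_pow, Real.sq_sqrt (by linarith)]
    have : s ≠ 0 := by linarith
    rw [hq]
    field_simp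
    ring
  rw [← h4] at h3
  exact Function.HasTemperateGrowth.comp Function.Complex.hasTemperateGrowth_ofReal h3

theorem fourierMul_toDistribution {g : ℝ → ℝ} (hg : EssBounded g)
    (ht : (fun ξ => (g ξ : ℂ)).HasTemperateGrowth) (f : L2) :
    (fourierMul g f : 𝓢'(ℝ, ℂ)) =
      TemperedDistribution.fourierMultiplierCLM ℂ (fun ξ => (g ξ : ℂ)) f := by
  rw [TemperedDistribution.fourierMultiplierCLM_apply, Lp.fourier_toTemperedDistribution_eq,
    ← Lp.toTemperedDistribution_smul_eq (r := 2) ht hg,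
    Lp.fourierInv_toTemperedDistribution_eq, ← mulOp_eq_smul]
  rfl

theorem fourierMultiplierCLM_sub {g₁ g₂ : ℝ → ℂ} (hg₁ : g₁.HasTemperateGrowth)
    (hg₂ : g₂.HasTemperateGrowth) :
    TemperedDistribution.fourierMultiplierCLM ℂ (g₁ - g₂) =
      TemperedDistribution.fourierMultiplierCLM ℂ g₁ -
        TemperedDistribution.fourierMultiplierCLM ℂ g₂ := by
  ext1 f
  simp only [sub_apply, TemperedDistribution.fourierMultiplierCLM_apply,
    TemperedDistribution.smulLeftCLM_sub hg₁ hg₂]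
  exact map_sub (FourierTransform.fourierInvCLM ℂ 𝓢'(ℝ, ℂ)) _ _

/-- The operator `(-∂_y² + s)⁻¹`, as a Fourier multiplier. -/
noncomputable abbrev resolventLaplacian (s : ℝ) : L2 →L[ℂ] L2 := fourierMul (resolventSymbol s)

/-- `(-∂_y² + s)⁻¹` is a left inverse of `-∂_y² + s` on `H²(ℝ)`. -/
theorem resolventLaplacian_apply_sub {s : ℝ} (hs : 1 ≤ s) (h : sobolevH2) :
    resolventLaplacian s ((s : ℂ) • (h : L2) - secondDeriv h) = h := by
  apply toTemperedDistribution_injective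
  have hd := secondDeriv_spec h
  have ht := resolventSymbol_temperate hs
  have hl : (fun ξ : ℝ => ((‖ξ‖ ^ 2 : ℝ) : ℂ)).HasTemperateGrowth := by fun_prop
  beta_reduce
  rw [fourierMul_toDistribution (resolventSymbol_essBounded hs) ht]
  simp only [← Lp.toTemperedDistributionCLM_apply, map_sub, map_smul] at hd ⊢
  rw [← hd]
  simp only [Lp.toTemperedDistributionCLM_apply,
    TemperedDistribution.laplacian_eq_fourierMultiplierCLM]
  rw [← Complex.coe_smul, map_smul,
    TemperedDistribution.fourierMultiplierCLM_fourierMultiplierCLM_apply hl ht]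
  have key : (s : ℂ) • (fun ξ => (resolventSymbol s ξ : ℂ)) -
      ((-(2 * Real.pi) ^ 2 : ℝ) : ℂ) •
      ((fun ξ : ℝ => ((‖ξ‖ ^ 2 : ℝ) : ℂ)) * (fun ξ => (resolventSymbol s ξ : ℂ))) =
      fun _ => 1 := by
    ext ξ
    have hp : (2 * Real.pi * ξ) ^ 2 + s ≠ 0 := by positivity
    simp only [Pi.smul_apply, Pi.mul_apply, Pi.sub_apply, smul_eq_mul, resolventSymbol,
      Real.norm_eq_abs, sq_abs]
    have : s * ((2 * Real.pi * ξ) ^ 2 + s)⁻¹ -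
      (-(2 * Real.pi) ^ 2) * (ξ ^ 2 * ((2 * Real.pi * ξ) ^ 2 + s)⁻¹) = 1 := by
      field_simp
      ring
    exact_mod_cast congrArg Complex.ofReal this
  have h1 := congrArg (fun g => TemperedDistribution.fourierMultiplierCLM ℂ g
    ((h : L2) : 𝓢'(ℝ, ℂ))) key
  beta_reduce at h1
  have ht1 : ((s : ℂ) • (fun ξ => (resolventSymbol s ξ : ℂ))).HasTemperateGrowth :=
    (Function.HasTemperateGrowth.const _).mul ht
  have ht2 : (((-(2 * Real.pi) ^ 2 : ℝ) : ℂ) • ((fun ξ : ℝ => ((‖ξ‖ ^ 2 : ℝ) : ℂ)) *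
      (fun ξ => (resolventSymbol s ξ : ℂ)))).HasTemperateGrowth :=
    (Function.HasTemperateGrowth.const _).mul (hl.mul ht)
  rw [fourierMultiplierCLM_sub ht1 ht2,
    TemperedDistribution.fourierMultiplierCLM_smul ht,
    TemperedDistribution.fourierMultiplierCLM_smul (hl.mul ht),
    TemperedDistribution.fourierMultiplierCLM_const, one_smul] at h1
  exact h1

theorem invLaplacian_eq_neg {α : ℤ} (hα : α ≠ 0) :
    invLaplacian α = -resolventLaplacian ((α : ℝ) ^ 2) := by
  have h : invLaplacian α = fourierMul (fun ξ => 0 - resolventSymbol ((α : ℝ) ^ 2) ξ) := by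
    change fourierMul (invSymbol α) = _
    congr 1
    ext ξ
    simp [invSymbol, resolventSymbol]
  have h0 : fourierMul (fun _ => 0) = 0 := by
    ext1 f
    rw [fourierMul_apply, mulOp_const, map_zero]
    exact map_zero (Lp.fourierTransformₗᵢ ℝ ℂ).symm
  rw [h, fourierMul_sub (essBounded_const 0) (resolventSymbol_essBounded (one_le_sq hα)), h0,
    zero_sub]

/-! ### The Birman–Schwinger operator -/

/-- The Birman–Schwinger operator `m (-∂_y² + s)⁻¹ m`. -/
noncomputable def birmanSchwinger (m : ℝ → ℝ) (s : ℝ) : L2 →L[ℂ] L2 :=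
  mulOp m * resolventLaplacian s * mulOp m

section BirmanSchwinger

variable {m : ℝ → ℝ}

theorem birmanSchwinger_nonneg (hm : EssBounded m) {s : ℝ} (hs : 1 ≤ s) :
    0 ≤ birmanSchwinger m s :=
  (mulOp_isSelfAdjoint hm).conjugate_nonneg
    (fourierMul_nonneg (resolventSymbol_essBounded hs) (resolventSymbol_nonneg hs))

theorem norm_birmanSchwinger_le (m : ℝ → ℝ) {s : ℝ} (hs : 1 ≤ s) :
    ‖birmanSchwinger m s‖ ≤ ‖mulOp m‖ ^ 2 * s⁻¹ := by
  have h1 := norm_fourierMul_le (resolventSymbol_essBounded hs) (by positivity)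
    (resolventSymbol_le hs)
  calc ‖birmanSchwinger m s‖ ≤ ‖mulOp m‖ * ‖resolventLaplacian s‖ * ‖mulOp m‖ :=
        norm_mul₃_le
    _ ≤ ‖mulOp m‖ * s⁻¹ * ‖mulOp m‖ := by gcongr
    _ = _ := by ring

theorem norm_birmanSchwinger_sub_le (m : ℝ → ℝ) {s t : ℝ} (hs : 1 ≤ s) (ht : 1 ≤ t) :
    ‖birmanSchwinger m s - birmanSchwinger m t‖ ≤ ‖mulOp m‖ ^ 2 * |s - t| := by
  have h1 := norm_fourierMul_le ((resolventSymbol_essBounded hs).sub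
    (resolventSymbol_essBounded ht)) (abs_nonneg _) (resolventSymbol_sub_le hs ht)
  rw [fourierMul_sub (resolventSymbol_essBounded hs) (resolventSymbol_essBounded ht)] at h1
  calc ‖birmanSchwinger m s - birmanSchwinger m t‖
      = ‖mulOp m * (resolventLaplacian s - resolventLaplacian t) * mulOp m‖ := by
        rw [mul_sub, sub_mul]; rfl
    _ ≤ ‖mulOp m‖ * ‖resolventLaplacian s - resolventLaplacian t‖ * ‖mulOp m‖ := norm_mul₃_le
    _ ≤ ‖mulOp m‖ * |s - t| * ‖mulOp m‖ := by gcongr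
    _ = _ := by ring

theorem continuousOn_norm_birmanSchwinger (m : ℝ → ℝ) :
    ContinuousOn (fun s => ‖birmanSchwinger m s‖) (Set.Ici 1) := by
  refine (LipschitzOnWith.of_dist_le_mul (K := ⟨‖mulOp m‖ ^ 2, by positivity⟩)
    fun s hs t ht => ?_).continuousOn
  rw [Real.dist_eq, Real.dist_eq]
  exact (abs_norm_sub_norm_le _ _).trans (norm_birmanSchwinger_sub_le m hs ht)

/-- The Birman–Schwinger principle: if `-s` is in the resolvent set of `-∂_y² - m²`, with resolvent
`R`, then `1 + m R m` inverts `1 - m (-∂_y² + s)⁻¹ m`. -/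
theorem isUnit_one_sub_birmanSchwinger (hm : EssBounded m) {s : ℝ} (hs : 1 ≤ s)
    (h : ((-s : ℝ) : ℂ) ∈ resolventSet (schrodinger fun y => -(m y) ^ 2)) :
    IsUnit (1 - birmanSchwinger m s) := by
  obtain ⟨R, hR, -⟩ := h
  have hneg : mulOp (fun y => -(m y) ^ 2) = -(mulOp m * mulOp m) := by
    rw [← mulOp_mul hm hm, ← zero_sub (mulOp _), ← map_zero (algebraMap ℝ (L2 →L[ℂ] L2)),
      ← mulOp_const, ← mulOp_sub (essBounded_const 0) (hm.mul hm)]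
    congr 1; ext y; ring
  have key : resolventLaplacian s * (mulOp m * mulOp m) * R = R - resolventLaplacian s := by
    ext1 x
    obtain ⟨hx, e⟩ := hR x
    have e' : mulOp (fun y => -(m y) ^ 2) (R x) - secondDeriv ⟨R x, hx⟩
        - ((-s : ℝ) : ℂ) • R x = x := e
    have h1 := resolventLaplacian_apply_sub hs ⟨R x, hx⟩
    have h2 : (mulOp m * mulOp m) (R x) = (s : ℂ) • R x - secondDeriv ⟨R x, hx⟩ - x := by
      have hsolve : ∀ a b c : L2, -a - b - ((-s : ℝ) : ℂ) • c = x → a = (s : ℂ) • c - b - x := by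
        rintro a b c rfl
        push_cast
        rw [neg_smul]
        abel
      rw [hneg] at e'
      exact hsolve _ _ _ e'
    rw [mul_apply_eq_comp, mul_apply_eq_comp, h2, map_sub, h1, sub_apply]
  have hsa : IsSelfAdjoint (1 - birmanSchwinger m s) :=
    (IsSelfAdjoint.one _).sub (IsSelfAdjoint.of_nonneg (birmanSchwinger_nonneg hm hs))
  have hr : (1 - birmanSchwinger m s) * (1 + mulOp m * R * mulOp m) = 1 := by
    have : birmanSchwinger m s * (mulOp m * R * mulOp m) =
        mulOp m * (resolventLaplacian s * (mulOp m * mulOp m) * R) * mulOp m := by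
      simp only [birmanSchwinger, mul_assoc]
    rw [sub_mul, mul_add (birmanSchwinger m s), this, key, birmanSchwinger]
    noncomm_ring
  have hl : star (1 + mulOp m * R * mulOp m) * (1 - birmanSchwinger m s) = 1 := by
    have := congrArg star hr
    rwa [star_mul, hsa.star_eq, star_one] at this
  exact isUnit_iff_exists.mpr ⟨_, hr, by rw [← left_inv_eq_right_inv hl hr]; exact hl⟩

/-- If the spectrum of `-∂_y² - m²` is above `-1` then the Birman–Schwinger operators have norm
less than one: their norm is in their spectrum, varies continuously with `s` and tends to zero, but
cannot be equal to one. -/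
theorem norm_birmanSchwinger_lt_one (hm : EssBounded m) {s : ℝ} (hs : 1 ≤ s)
    (h : ∀ t : ℝ, 1 ≤ t → ((-t : ℝ) : ℂ) ∈ resolventSet (schrodinger fun y => -(m y) ^ 2)) :
    ‖birmanSchwinger m s‖ < 1 := by
  by_contra! hge
  set t := max s (‖mulOp m‖ ^ 2 + 1)
  have ht : 1 ≤ t := hs.trans (le_max_left _ _)
  have hlt : ‖birmanSchwinger m t‖ ≤ 1 := by
    refine (norm_birmanSchwinger_le m ht).trans ?_
    rw [mul_inv_le_iff₀ (by linarith)]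
    linarith [le_max_right s (‖mulOp m‖ ^ 2 + 1)]
  have hc := (continuousOn_norm_birmanSchwinger m).mono
    (show Set.Icc s t ⊆ Set.Ici 1 from fun x hx => hs.trans hx.1)
  obtain ⟨r, hr, e⟩ := intermediate_value_Icc' (le_max_left _ _) hc ⟨hlt, hge⟩
  have hr1 : 1 ≤ r := hs.trans hr.1
  have : Nontrivial (L2 →L[ℂ] L2) := by
    refine ⟨⟨birmanSchwinger m r, 0, fun h0 => ?_⟩⟩
    simp [h0] at e
  -- at `r`, where the norm is one, `1` is in the spectrum: this contradicts invertibility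
  have hmem := CStarAlgebra.norm_mem_spectrum_of_nonneg (birmanSchwinger_nonneg hm hr1)
  beta_reduce at e
  rw [e, spectrum.mem_iff, map_one] at hmem
  exact hmem (isUnit_one_sub_birmanSchwinger hm hr1 (h r hr1))

end BirmanSchwinger

/-! ### Fourier integrals and the Fourier transform on `L²` -/

theorem integral_fourier_smul_eq {f g : ℝ → ℂ} (hf : Integrable f) (hg : Integrable g) :
    ∫ ξ, 𝓕 f ξ • g ξ = ∫ x, f x • 𝓕 g x := by
  have := VectorFourier.integral_fourierIntegral_smul_eq_flip (μ := volume) (ν := volume)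
    (L := innerₗ ℝ) Real.continuous_fourierChar continuous_inner hf hg
  rwa [flip_innerₗ] at this

theorem integral_fourierInv_smul_eq {f g : ℝ → ℂ} (hf : Integrable f) (hg : Integrable g) :
    ∫ ξ, 𝓕⁻ f ξ • g ξ = ∫ x, f x • 𝓕⁻ g x := by
  have h := integral_fourier_smul_eq (hf.comp_neg) hg
  simp only [Real.fourierInv_eq_fourier_comp_neg] at h ⊢
  rw [h, ← integral_neg_eq_self]
  simp only [neg_neg]
  refine integral_congr_ae (ae_of_all _ fun x => ?_)
  beta_reduce
  rw [← Real.fourierInv_eq_fourier_neg, Real.fourierInv_eq_fourier_comp_neg]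

theorem continuous_fourier {f : ℝ → ℂ} (hf : Integrable f) : Continuous (𝓕 f) :=
  VectorFourier.fourierIntegral_continuous Real.continuous_fourierChar continuous_inner hf

theorem continuous_fourierInv {f : ℝ → ℂ} (hf : Integrable f) : Continuous (𝓕⁻ f) := by
  rw [Real.fourierInv_eq_fourier_comp_neg]
  exact continuous_fourier hf.comp_neg

/-- On `L¹ ∩ L²` the `L²` Fourier transform is given by the Fourier integral: both have the same
integrals against test functions. -/
theorem coeFn_fourier_toLp {p : ℝ → ℂ} (h1 : Integrable p) (h2 : MemLp p 2) :
    (𝓕 (h2.toLp p) : L2) =ᵐ[volume] 𝓕 p := by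
  refine ae_eq_of_integral_contDiff_smul_eq ((Lp.memLp _).locallyIntegrable one_le_two)
    (continuous_fourier h1).locallyIntegrable fun g hg hc => ?_
  have hc' : HasCompactSupport (fun x => (g x : ℂ)) := hc.comp_left (g := Complex.ofReal) rfl
  have hg' : ContDiff ℝ ∞ (fun x => (g x : ℂ)) := Complex.ofRealCLM.contDiff.comp hg
  set G : 𝓢(ℝ, ℂ) := hc'.toSchwartzMap hg'
  have hG : ∀ x, G x = (g x : ℂ) := fun x => rfl
  have e := congrArg (fun T : 𝓢'(ℝ, ℂ) => T G) (Lp.fourier_toTemperedDistribution_eq (h2.toLp p))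
  simp only [TemperedDistribution.fourier_apply, Lp.toTemperedDistribution_apply] at e
  simp only [← Complex.coe_smul, ← hG]
  rw [← e, ← integral_fourier_smul_eq G.integrable h1]
  refine integral_congr_ae ?_
  filter_upwards [h2.coeFn_toLp] with x hx
  rw [hx, SchwartzMap.fourier_coe]

/-- On `L¹ ∩ L²` the inverse `L²` Fourier transform is given by the inverse Fourier integral. -/
theorem coeFn_fourierInv_toLp {p : ℝ → ℂ} (h1 : Integrable p) (h2 : MemLp p 2) :
    (𝓕⁻ (h2.toLp p) : L2) =ᵐ[volume] 𝓕⁻ p := by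
  refine ae_eq_of_integral_contDiff_smul_eq ((Lp.memLp _).locallyIntegrable one_le_two)
    (continuous_fourierInv h1).locallyIntegrable fun g hg hc => ?_
  have hc' : HasCompactSupport (fun x => (g x : ℂ)) := hc.comp_left (g := Complex.ofReal) rfl
  have hg' : ContDiff ℝ ∞ (fun x => (g x : ℂ)) := Complex.ofRealCLM.contDiff.comp hg
  set G : 𝓢(ℝ, ℂ) := hc'.toSchwartzMap hg'
  have hG : ∀ x, G x = (g x : ℂ) := fun x => rfl
  have e := congrArg (fun T : 𝓢'(ℝ, ℂ) => T G)
    (Lp.fourierInv_toTemperedDistribution_eq (h2.toLp p))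
  simp only [TemperedDistribution.fourierInv_apply, Lp.toTemperedDistribution_apply] at e
  simp only [← Complex.coe_smul, ← hG]
  rw [← e, ← integral_fourierInv_smul_eq G.integrable h1]
  refine integral_congr_ae ?_
  filter_upwards [h2.coeFn_toLp] with x hx
  rw [hx, SchwartzMap.fourierInv_coe]

theorem hasDerivAt_fourierInv {p : ℝ → ℂ} (hp : Integrable p)
    (hp' : Integrable (fun ξ : ℝ => (2 * Real.pi * Complex.I * ξ) * p ξ)) (x : ℝ) :
    HasDerivAt (𝓕⁻ p) (𝓕⁻ (fun ξ : ℝ => (2 * Real.pi * Complex.I * ξ) * p ξ) x) x := by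
  have hx : Integrable (fun ξ : ℝ => ξ • p ξ) := by
    refine (hp'.const_mul (2 * Real.pi * Complex.I)⁻¹).congr (ae_of_all _ fun ξ => ?_)
    have := Complex.two_pi_I_ne_zero
    simp only [Complex.real_smul]
    field_simp
  have h := (Real.hasDerivAt_fourier hp hx (-x)).scomp x (hasDerivAt_neg x)
  have e : (𝓕⁻ p) = 𝓕 p ∘ Neg.neg := by
    ext y; exact Real.fourierInv_eq_fourier_neg p y
  rw [e, Real.fourierInv_eq_fourier_neg]
  convert! h using 1
  rw [Real.fourier_eq, Real.fourier_eq, ← integral_smul]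
  refine integral_congr_ae (ae_of_all _ fun ξ => ?_)
  simp only [Circle.smul_def, smul_eq_mul, neg_smul, one_smul]
  ring

theorem tendsto_fourierInv_cocompact (p : ℝ → ℂ) : Tendsto (𝓕⁻ p) (cocompact ℝ) (𝓝 0) := by
  have e : (𝓕⁻ p) = 𝓕 p ∘ Neg.neg := by
    ext y; exact Real.fourierInv_eq_fourier_neg p y
  rw [e]
  exact (Real.zero_at_infty_fourier p).comp (Homeomorph.neg ℝ).isClosedEmbedding.tendsto_cocompact

theorem norm_fourierInv_le (p : ℝ → ℂ) (x : ℝ) : ‖𝓕⁻ p x‖ ≤ ∫ ξ, ‖p ξ‖ := by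
  rw [Real.fourierInv_eq_fourier_neg]
  exact VectorFourier.norm_fourierIntegral_le_integral_norm _ _ _ _ _

/-- If `i ξ P` (with the normalising factor `2π`) is the `L²` Fourier transform of `G`, then the
inverse Fourier integral of `P` is a primitive of `G`: the integral of `G` over an interval is the
inner product with an indicator function, which Plancherel's theorem turns into
the increment of `𝓕⁻ P`. -/
theorem fourierInv_sub_eq_integral {P : ℝ → ℂ} (hP : Integrable P) {G : L2}
    (hG : (𝓕 G : L2) =ᵐ[volume] fun ξ : ℝ => (2 * Real.pi * Complex.I * ξ) * P ξ) {a b : ℝ}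
    (hab : a ≤ b) : 𝓕⁻ P b - 𝓕⁻ P a = ∫ x in a..b, G x := by
  have hfin : volume (Set.Ioc a b) ≠ (⊤ : ℝ≥0∞) := by simp
  rw [intervalIntegral.integral_of_le hab,
    ← L2.inner_indicatorConstLp_one measurableSet_Ioc hfin, ← Lp.inner_fourier_eq, L2.inner_def]
  have hind := coeFn_fourier_toLp ((integrable_indicator_iff measurableSet_Ioc).mpr
    (integrableOn_const hfin)) (memLp_indicator_const 2 measurableSet_Ioc (1 : ℂ) (Or.inr hfin))
  have hchar : ∀ ξ : ℝ, (starRingEnd ℂ) (𝓕 ((Set.Ioc a b).indicator fun _ => (1 : ℂ)) ξ) *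
      (2 * Real.pi * Complex.I * ξ) =
      Complex.exp (2 * Real.pi * Complex.I * ξ * b) - Complex.exp (2 * Real.pi * Complex.I * ξ * a)
      := by
    intro ξ
    rcases eq_or_ne ξ 0 with rfl | h0
    · simp
    have hc : (2 * Real.pi * Complex.I * ξ : ℂ) ≠ 0 :=
      mul_ne_zero Complex.two_pi_I_ne_zero (by exact_mod_cast h0)
    rw [Real.fourier_real_eq_integral_exp_smul, ← integral_conj]
    have : ∀ v : ℝ, (starRingEnd ℂ) (Complex.exp (↑(-2 * Real.pi * v * ξ) * Complex.I) •
        (Set.Ioc a b).indicator (fun _ => (1 : ℂ)) v) =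
        (Set.Ioc a b).indicator
          (fun v : ℝ => Complex.exp (2 * Real.pi * Complex.I * ξ * v)) v := by
      intro v
      by_cases hv : v ∈ Set.Ioc a b
      · rw [Set.indicator_of_mem hv, Set.indicator_of_mem hv, smul_eq_mul, mul_one,
          ← Complex.exp_conj]
        congr 1
        rw [map_mul, Complex.conj_ofReal, Complex.conj_I]
        push_cast
        ring
      · rw [Set.indicator_of_notMem hv, Set.indicator_of_notMem hv, smul_zero, map_zero]
    simp only [this]
    rw [integral_indicator measurableSet_Ioc, ← intervalIntegral.integral_of_le hab,
      integral_exp_mul_complex hc, div_mul_cancel₀ _ hc]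
  have hint : ∀ x : ℝ, 𝓕⁻ P x = ∫ ξ : ℝ, Complex.exp (2 * Real.pi * Complex.I * ξ * x) * P ξ := by
    intro x
    rw [Real.fourierInv_eq']
    refine integral_congr_ae (ae_of_all _ fun ξ => ?_)
    simp
    left; congr 1; ring
  have hexp : ∀ x : ℝ, Integrable
      (fun ξ : ℝ => Complex.exp (2 * Real.pi * Complex.I * ξ * x) * P ξ) := by
    intro x
    refine hP.bdd_mul (c := 1) (by fun_prop) (ae_of_all _ fun ξ => ?_)
    rw [show (2 * Real.pi * Complex.I * ξ * x : ℂ) = ((2 * Real.pi * ξ * x : ℝ) : ℂ) * Complex.I by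
      push_cast; ring, Complex.norm_exp_ofReal_mul_I]
  rw [hint, hint, ← integral_sub (hexp b) (hexp a)]
  refine integral_congr_ae ?_
  filter_upwards [hind, hG] with ξ h1 h2
  have h1' : (𝓕 (indicatorConstLp 2 measurableSet_Ioc hfin (1 : ℂ)) : L2) ξ =
    𝓕 ((Set.Ioc a b).indicator fun _ => (1 : ℂ)) ξ := h1
  rw [h1', h2, ← sub_mul, ← hchar, RCLike.inner_apply]
  ring

/-- The Cauchy–Schwarz inequality in `L²`. -/
theorem integral_norm_mul_norm_le (f g : L2) : ∫ x, ‖f x‖ * ‖g x‖ ≤ ‖f‖ * ‖g‖ := by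
  have hf := (Lp.memLp f).norm
  have hg := (Lp.memLp g).norm
  have h := real_inner_le_norm (hf.toLp _) (hg.toLp _)
  rw [L2.inner_def, Lp.norm_toLp, Lp.norm_toLp, eLpNorm_norm, eLpNorm_norm, ← Lp.norm_def,
    ← Lp.norm_def] at h
  refine (integral_congr_ae ?_).trans_le h
  filter_upwards [hf.coeFn_toLp, hg.coeFn_toLp] with x h1 h2
  rw [h1, h2, real_inner_eq_re_inner, RCLike.inner_apply]
  simp [mul_comm]

/-! ### Regularity of `(-∂_y² + s)⁻¹ F` -/

theorem continuous_resolventSymbol {s : ℝ} (hs : 1 ≤ s) : Continuous (resolventSymbol s) := by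
  unfold resolventSymbol
  refine Continuous.inv₀ (by fun_prop) fun ξ => ?_
  positivity

theorem integrable_resolventSymbol {s : ℝ} (hs : 1 ≤ s) : Integrable (resolventSymbol s) := by
  refine integrable_inv_one_add_sq.mono' (continuous_resolventSymbol hs).aestronglyMeasurable
    (ae_of_all _ fun ξ => ?_)
  rw [Real.norm_eq_abs, abs_of_nonneg (resolventSymbol_nonneg hs ξ)]
  have h3 : (1 : ℝ) ≤ (2 * Real.pi) ^ 2 := by nlinarith [Real.pi_gt_three]
  refine inv_anti₀ (by positivity) ?_
  nlinarith [sq_nonneg ξ]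

theorem memLp_two_resolventSymbol {s : ℝ} (hs : 1 ≤ s) :
    MemLp (fun ξ => (resolventSymbol s ξ : ℂ)) 2 := by
  have hc := continuous_resolventSymbol hs
  rw [memLp_two_iff_integrable_sq_norm (by fun_prop)]
  refine (integrable_resolventSymbol hs).mono'
    (by fun_prop) (ae_of_all _ fun ξ => ?_)
  have h0 := resolventSymbol_nonneg hs ξ
  have h1 := (resolventSymbol_le hs ξ).trans (inv_le_one_of_one_le₀ hs)
  rw [abs_of_nonneg h0] at h1
  rw [Complex.norm_real, Real.norm_eq_abs, Real.norm_eq_abs, sq_abs, abs_of_nonneg (sq_nonneg _)]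
  nlinarith

theorem memLp_two_mul_resolventSymbol {s : ℝ} (hs : 1 ≤ s) :
    MemLp (fun ξ : ℝ => 2 * Real.pi * Complex.I * ξ * (resolventSymbol s ξ : ℂ)) 2 := by
  have hc := continuous_resolventSymbol hs
  rw [memLp_two_iff_integrable_sq_norm (by fun_prop)]
  refine (integrable_resolventSymbol hs).mono' (by fun_prop) (ae_of_all _ fun ξ => ?_)
  have h0 := resolventSymbol_nonneg hs ξ
  have h1 : (2 * Real.pi * ξ) ^ 2 * resolventSymbol s ξ ≤ 1 := by
    unfold resolventSymbol
    rw [mul_inv_le_iff₀ (by positivity)]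
    linarith
  have h2 : ‖2 * Real.pi * Complex.I * ξ * (resolventSymbol s ξ : ℂ)‖ ^ 2 =
      (2 * Real.pi * ξ) ^ 2 * resolventSymbol s ξ ^ 2 := by
    simp [abs_of_pos Real.pi_pos, mul_pow, sq_abs]
  rw [Real.norm_eq_abs, abs_of_nonneg (sq_nonneg _), h2]
  nlinarith

/-- For `F` in `L²`, the function `(-∂_y² + s)⁻¹ F` has a representative `φ` that is `C¹`, vanishes
at infinity with its derivative, is bounded by a multiple of the `L²` norm of `F`, and satisfies the
equation `φ'' = s φ - F` in integrated form. -/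
theorem exists_regular_resolventLaplacian {s : ℝ} (hs : 1 ≤ s) : ∃ K : ℝ, 0 ≤ K ∧ ∀ F : L2,
    ∃ φ φ' : ℝ → ℂ, (resolventLaplacian s F : ℝ → ℂ) =ᵐ[volume] φ ∧
      (∀ x, HasDerivAt φ (φ' x) x) ∧ Continuous φ' ∧ Tendsto φ (cocompact ℝ) (𝓝 0) ∧
      Tendsto φ' (cocompact ℝ) (𝓝 0) ∧ (∀ x, ‖φ x‖ ≤ K * ‖F‖) ∧
      ∀ a b, a ≤ b → φ' b - φ' a = ∫ x in a..b, (s * φ x - F x) := by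
  have hr2 := memLp_two_resolventSymbol hs
  refine ⟨‖hr2.toLp _‖, norm_nonneg _, fun F => ?_⟩
  set ψ : L2 := 𝓕 F
  set r : ℝ → ℝ := resolventSymbol s
  set p : ℝ → ℂ := fun ξ => r ξ * ψ ξ
  set P : ℝ → ℂ := fun ξ => (2 * Real.pi * Complex.I * ξ) * p ξ
  have hp1 : Integrable p := hr2.integrable_mul (Lp.memLp ψ)
  have hP1 : Integrable P := by
    refine ((memLp_two_mul_resolventSymbol hs).integrable_mul (Lp.memLp ψ)).congr
      (ae_of_all _ fun ξ => ?_)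
    simp only [Pi.mul_apply, P, p, r]
    ring
  have hmul : mulOp r ψ =ᵐ[volume] p := mulOp_coeFn (resolventSymbol_essBounded hs) ψ
  have hp2 : MemLp p 2 := (Lp.memLp (mulOp r ψ)).ae_eq hmul
  have hres : resolventLaplacian s F = 𝓕⁻ (hp2.toLp p) := by
    rw [fourierMul_apply]
    congr 1
    exact Lp.ext (hmul.trans hp2.coeFn_toLp.symm)
  have hφ : (resolventLaplacian s F : ℝ → ℂ) =ᵐ[volume] 𝓕⁻ p := by
    rw [hres]; exact coeFn_fourierInv_toLp hp1 hp2
  refine ⟨𝓕⁻ p, 𝓕⁻ P, hφ, hasDerivAt_fourierInv hp1 hP1, continuous_fourierInv hP1,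
    tendsto_fourierInv_cocompact _, tendsto_fourierInv_cocompact _, fun x => ?_, fun a b hab => ?_⟩
  · refine (norm_fourierInv_le p x).trans ?_
    have hcs := integral_norm_mul_norm_le (hr2.toLp _) ψ
    rw [Lp.norm_fourier_eq] at hcs
    refine (integral_congr_ae ?_).trans_le hcs
    filter_upwards [hr2.coeFn_toLp] with ξ h
    rw [h, norm_mul]
  · have hG : (𝓕 ((s : ℂ) • resolventLaplacian s F - F) : L2) =ᵐ[volume]
        fun ξ : ℝ => (2 * Real.pi * Complex.I * ξ) * P ξ := by
      have e : (𝓕 ((s : ℂ) • resolventLaplacian s F - F) : L2) = (s : ℂ) • hp2.toLp p - ψ := by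
        rw [hres, sub_eq_add_neg, FourierTransform.fourier_add, FourierTransform.fourier_neg,
          FourierTransform.fourier_smul, FourierTransform.fourier_fourierInv_eq, ← sub_eq_add_neg]
      rw [e]
      filter_upwards [Lp.coeFn_sub ((s : ℂ) • hp2.toLp p) ψ, Lp.coeFn_smul (s : ℂ) (hp2.toLp p),
        hp2.coeFn_toLp] with ξ h1 h2 h3
      rw [h1, Pi.sub_apply, h2, Pi.smul_apply, h3]
      have hne : (2 * Real.pi * ξ) ^ 2 + s ≠ 0 := by positivity
      have hr : s * r ξ - 1 = -(2 * Real.pi * ξ) ^ 2 * r ξ := by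
        simp only [r, resolventSymbol]
        field_simp
        ring
      have hr' : (s : ℂ) * r ξ - 1 = -(2 * Real.pi * ξ) ^ 2 * r ξ := by
        exact_mod_cast congrArg Complex.ofReal hr
      simp only [P, p, smul_eq_mul]
      linear_combination ψ ξ * hr' - (2 * Real.pi * ξ) ^ 2 * r ξ * ψ ξ * Complex.I_sq
    rw [fourierInv_sub_eq_integral hP1 hG hab]
    refine intervalIntegral.integral_congr_ae ?_
    filter_upwards [Lp.coeFn_sub ((s : ℂ) • resolventLaplacian s F) F,
      Lp.coeFn_smul (s : ℂ) (resolventLaplacian s F), hφ] with x h1 h2 h3 _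
    rw [h1, Pi.sub_apply, h2, Pi.smul_apply, h3, smul_eq_mul]

/-! ### An energy identity for the Rayleigh equation -/

/-- If `v (φ'' - α² φ) = v'' φ` with `v ≠ 0` on an open interval `I`, then
`W = φ φ' - (v' / v) φ²` has derivative `α² φ² + (φ' - (v' / v) φ)²`; so if `W` tends to zero at
both ends of `I` then `φ` vanishes. The ends are represented by filters `l₁` and `l₂`. -/
theorem rayleigh_eq_zero {I : Set ℝ} (hI : IsOpen I) (hconv : Convex ℝ I) {l₁ l₂ : Filter ℝ}
    [l₁.NeBot] [l₂.NeBot] (hl₁ : ∀ x ∈ I, ∀ᶠ y in l₁, y ∈ I ∧ y ≤ x)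
    (hl₂ : ∀ x ∈ I, ∀ᶠ y in l₂, y ∈ I ∧ x ≤ y)
    {v v' v'' φ φ' : ℝ → ℝ} {A : ℝ} (hA : 0 < A) (hv : ∀ x, HasDerivAt v (v' x) x)
    (hv' : ∀ x, HasDerivAt v' (v'' x) x) (hne : ∀ x ∈ I, v x ≠ 0)
    (hφ : ∀ x, HasDerivAt φ (φ' x) x)
    (hφ' : ∀ x ∈ I, HasDerivAt φ' (v'' x / v x * φ x + A * φ x) x)
    (h₁ : Tendsto (fun x => φ x * φ' x - v' x / v x * φ x ^ 2) l₁ (𝓝 0))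
    (h₂ : Tendsto (fun x => φ x * φ' x - v' x / v x * φ x ^ 2) l₂ (𝓝 0)) :
    ∀ x ∈ I, φ x = 0 := by
  set W : ℝ → ℝ := fun x => φ x * φ' x - v' x / v x * φ x ^ 2
  have hW : ∀ x ∈ I, HasDerivAt W (A * φ x ^ 2 + (φ' x - v' x / v x * φ x) ^ 2) x := by
    intro x hx
    have h := ((hφ x).mul (hφ' x hx)).sub (((hv' x).div (hv x) (hne x hx)).mul ((hφ x).pow 2))
    convert! h using 1
    have := hne x hx
    simp only [Pi.pow_apply, Pi.div_apply]
    field_simp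
    push_cast
    ring
  have hmono : MonotoneOn W I := by
    refine monotoneOn_of_deriv_nonneg hconv
      (fun x hx => (hW x hx).continuousAt.continuousWithinAt)
      (fun x hx => (hW x (interior_subset hx)).differentiableAt.differentiableWithinAt)
      fun x hx => ?_
    rw [(hW x (interior_subset hx)).deriv]
    positivity
  have hzero : ∀ x ∈ I, W x = 0 := by
    intro x hx
    refine le_antisymm (ge_of_tendsto h₂ ?_) (le_of_tendsto h₁ ?_)
    · filter_upwards [hl₂ x hx] with y hy using hmono hx hy.1 hy.2
    · filter_upwards [hl₁ x hx] with y hy using hmono hy.1 hx hy.2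
  intro x hx
  have h0 : HasDerivAt W 0 x := by
    refine (hasDerivAt_const x (0 : ℝ)).congr_of_eventuallyEq ?_
    filter_upwards [hI.mem_nhds hx] with y hy using hzero y hy
  have h1 := (hW x hx).unique h0
  have h2 : A * φ x ^ 2 = 0 :=
    le_antisymm (by nlinarith [sq_nonneg (φ' x - v' x / v x * φ x)]) (by positivity)
  simpa [hA.ne'] using h2

/-! ### Profiles -/

/-- Along some sequence tending to `+∞`, the derivative of a function converging at `+∞` tends to
zero. -/
theorem exists_seq_deriv_tendsto_zero {f f' : ℝ → ℝ} (hf : ∀ x, HasDerivAt f (f' x) x) {L : ℝ}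
    (hL : Tendsto f atTop (𝓝 L)) :
    ∃ u : ℕ → ℝ, Tendsto u atTop atTop ∧ Tendsto (fun n => f' (u n)) atTop (𝓝 0) := by
  have h : ∀ n : ℕ, ∃ c ∈ Set.Ioo (n : ℝ) (n + 1), f' c = f (n + 1) - f n := by
    intro n
    obtain ⟨c, hc, e⟩ := exists_hasDerivAt_eq_slope f f' (show (n : ℝ) < n + 1 by linarith)
      (fun x _ => (hf x).continuousAt.continuousWithinAt) fun x _ => hf x
    exact ⟨c, hc, by rw [e]; simp⟩
  choose u hu e using h
  refine ⟨u, tendsto_atTop_mono (fun n => (hu n).1.le) tendsto_natCast_atTop_atTop, ?_⟩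
  have h1 := hL.comp (tendsto_natCast_atTop_atTop (R := ℝ))
  have h2 := hL.comp (tendsto_atTop_add_const_right _ (1 : ℝ)
    (tendsto_natCast_atTop_atTop (R := ℝ)))
  simpa [e, Function.comp_def] using h2.sub h1

/-- A positive decreasing function with `v'' ≤ C v` that tends to zero satisfies
`(v')² ≤ C v²`. -/
theorem neg_deriv_le_of_tendsto_zero {v v' v'' : ℝ → ℝ} {C : ℝ}
    (hv : ∀ x, HasDerivAt v (v' x) x) (hv' : ∀ x, HasDerivAt v' (v'' x) x)
    (hpos : ∀ x, 0 ≤ v x) (hneg : ∀ x, v' x ≤ 0) (hC : ∀ x, v'' x ≤ C * v x)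
    (hlim : Tendsto v atTop (𝓝 0)) (x : ℝ) : -v' x ≤ √C * v x := by
  -- this energy is nondecreasing and tends to zero along a sequence going to `+∞`
  set E : ℝ → ℝ := fun x => v' x ^ 2 - C * v x ^ 2
  have hE : ∀ x, HasDerivAt E (2 * v' x * (v'' x - C * v x)) x := by
    intro x
    have h := ((hv' x).pow 2).sub (((hv x).pow 2).const_mul C)
    convert! h using 1
    push_cast
    ring
  have hmono : Monotone E := monotone_of_hasDerivAt_nonneg hE fun x =>
    mul_nonneg_of_nonpos_of_nonpos (by linarith [hneg x]) (by linarith [hC x])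
  obtain ⟨u, hu, hu'⟩ := exists_seq_deriv_tendsto_zero hv hlim
  have hEu : Tendsto (fun n => E (u n)) atTop (𝓝 0) := by
    simpa using (hu'.pow 2).sub (((hlim.comp hu).pow 2).const_mul C)
  have hle : E x ≤ 0 := by
    refine ge_of_tendsto hEu ?_
    filter_upwards [hu.eventually_ge_atTop x] with n hn using hmono hn
  have h1 : (-v' x) ^ 2 ≤ C * v x ^ 2 := by simp only [E] at hle; linarith
  calc -v' x ≤ √(C * v x ^ 2) := Real.le_sqrt_of_sq_le h1
    _ = √C * v x := by rw [Real.sqrt_mul' _ (sq_nonneg _), Real.sqrt_sq (hpos x)]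

theorem le_of_ae_le {f : ℝ → ℝ} (hf : Continuous f) {C : ℝ} (h : ∀ᵐ y, f y ≤ C) (y : ℝ) :
    f y ≤ C := by
  by_contra! hy
  have ho : IsOpen {y | C < f y} := isOpen_lt continuous_const hf
  have h0 : volume {y | C < f y} = 0 := by
    simpa [ae_iff, not_le] using h
  exact Set.notMem_empty y ((ho.measure_eq_zero_iff volume).mp h0 ▸ hy)

theorem exists_abs_bound_of_memLp_top {f : ℝ → ℝ} (hf : MemLp f ∞ (volume : Measure ℝ)) :
    ∃ C : ℝ, 0 ≤ C ∧ ∀ᵐ y, |f y| ≤ C :=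
  EssBounded.exists_bound (g := f) hf.ofReal

theorem intervalIntegrable_coeFn (f : L2) (a b : ℝ) : IntervalIntegrable f volume a b :=
  (((Lp.memLp f).locallyIntegrable one_le_two).integrableOn_isCompact
    isCompact_uIcc).intervalIntegrable

namespace H1

variable {U : ℝ → ℝ} {Um Up : ℝ} (h : H1 U Um Up)
include h

theorem hasDerivAt (x : ℝ) : HasDerivAt U (deriv U x) x :=
  (h.smooth.differentiable (by simp) x).hasDerivAt

theorem continuous : Continuous U := h.smooth.continuous

theorem hasDerivAt_deriv (x : ℝ) : HasDerivAt (deriv U) (iteratedDeriv 2 U x) x := by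
  rw [iteratedDeriv_succ, iteratedDeriv_one]
  have : Differentiable ℝ (deriv U) := by
    rw [← iteratedDeriv_one]
    exact h.smooth.differentiable_iteratedDeriv 1 (by exact_mod_cast ENat.natCast_lt_top 1)
  exact (this x).hasDerivAt

theorem continuous_deriv : Continuous (deriv U) :=
  continuous_iff_continuousAt.mpr fun x => (h.hasDerivAt_deriv x).continuousAt

theorem continuous_iteratedDeriv_two : Continuous (iteratedDeriv 2 U) :=
  h.smooth.continuous_iteratedDeriv 2 (WithTop.coe_le_coe.mpr le_top)

theorem strictMono : StrictMono U := strictMono_of_deriv_pos h.deriv_pos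

theorem lt_top (x : ℝ) : U x < Up :=
  (h.strictMono (lt_add_one x)).trans_le (h.strictMono.monotone.ge_of_tendsto h.tendsto_top _)

theorem bot_lt (x : ℝ) : Um < U x :=
  (h.strictMono.monotone.le_of_tendsto h.tendsto_bot _).trans_lt (h.strictMono (sub_one_lt x))

theorem ae_ne (c : ℝ) : ∀ᵐ y, U y ≠ c := by
  rw [ae_iff]
  refine Set.Subsingleton.measure_zero (fun x hx y hy => ?_) _
  simp only [Set.mem_ofPred_eq, not_not] at hx hy
  exact h.strictMono.injective (hx.trans hy.symm)

theorem quotU_eq {y : ℝ} (hy : U y ≠ 0) : quotU U y = iteratedDeriv 2 U y / U y := by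
  refine extendFrom_eq (subset_closure hy) ?_
  exact (h.continuous_iteratedDeriv_two.continuousAt.div h.continuous.continuousAt
    hy).continuousWithinAt

theorem quot_lt {y : ℝ} (hy : U y ≠ 0) : iteratedDeriv 2 U y / U y < 0 :=
  h.quotU_eq hy ▸ h.quot_neg y

/-- A positive profile would be concave and increasing on `ℝ` but bounded below. -/
theorem bot_neg : Um < 0 := by
  by_contra! h0
  have hpos : ∀ y, 0 < U y := fun y => h0.trans_lt (h.bot_lt y)
  have hanti : Antitone (deriv U) := antitone_of_hasDerivAt_nonpos h.hasDerivAt_deriv fun y =>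
    ((div_neg_iff.mp (h.quot_lt (hpos y).ne')).resolve_left fun hc => (hpos y).not_gt hc.2).1.le
  obtain ⟨u, hu, hu'⟩ := exists_seq_deriv_tendsto_zero (f := fun x => U (-x))
    (fun x => by simpa using! (h.hasDerivAt (-x)).scomp x (hasDerivAt_neg x))
    (h.tendsto_bot.comp tendsto_neg_atTop_atBot)
  refine (h.deriv_pos 0).not_ge (ge_of_tendsto (by simpa using hu'.neg) ?_)
  filter_upwards [hu.eventually_ge_atTop 0] with n hn
  simpa using hanti (show -u n ≤ 0 by linarith)

/-- A negative profile would be convex and increasing on `ℝ` but bounded above. -/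
theorem top_pos : 0 < Up := by
  by_contra! h0
  have hneg : ∀ y, U y < 0 := fun y => (h.lt_top y).trans_le h0
  have hmono : Monotone (deriv U) := monotone_of_hasDerivAt_nonneg h.hasDerivAt_deriv fun y =>
    ((div_neg_iff.mp (h.quot_lt (hneg y).ne)).resolve_right fun hc => (hneg y).not_gt hc.2).1.le
  obtain ⟨u, hu, hu'⟩ := exists_seq_deriv_tendsto_zero h.hasDerivAt h.tendsto_top
  refine (h.deriv_pos 0).not_ge (ge_of_tendsto hu' ?_)
  filter_upwards [hu.eventually_ge_atTop 0] with n hn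
  exact hmono hn

theorem m_sq {y : ℝ} (hy : U y ≠ 0) : m U y ^ 2 = -(iteratedDeriv 2 U y / U y) := by
  rw [m, Real.sq_sqrt (by linarith [h.quot_neg y]), h.quotU_eq hy]

theorem m_pos (y : ℝ) : 0 < m U y := Real.sqrt_pos.mpr (by linarith [h.quot_neg y])

theorem essBounded_m : EssBounded (m U) := by
  obtain ⟨C, hC, hb⟩ := exists_abs_bound_of_memLp_top h.quot_bounded
  have hm : AEStronglyMeasurable (m U) volume := by
    refine (Real.continuous_sqrt.comp_aestronglyMeasurable h.quot_bounded.1.neg).congr ?_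
    filter_upwards [h.ae_ne 0] with y hy
    simp [m, h.quotU_eq hy]
  refine essBounded_of_bound (C := √C) hm ?_
  filter_upwards [hb, h.ae_ne 0] with y h1 hy
  rw [abs_of_pos (h.m_pos y), m, h.quotU_eq hy]
  exact Real.sqrt_le_sqrt ((neg_le_abs _).trans h1)

theorem essBounded : EssBounded U :=
  essBounded_of_bound h.continuous.aestronglyMeasurable (C := max |Up| |Um|)
    (ae_of_all _ fun y => by
      have := abs_le_max_abs_abs (h.bot_lt y).le (h.lt_top y).le
      rwa [max_comm] at this)

/-- `U'` is bounded by a multiple of the distance of `U` to its limit at `+∞`. -/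
theorem exists_deriv_le_top (h2 : H2 U Um Up) : ∃ K, ∀ x, deriv U x ≤ K * (Up - U x) := by
  obtain ⟨C, hC, hb⟩ := exists_abs_bound_of_memLp_top h2.quot_plus_bounded
  have hne : ∀ y, U y - Up ≠ 0 := fun y => (sub_neg.mpr (h.lt_top y)).ne
  have hb' : ∀ y, |iteratedDeriv 2 U y / (U y - Up)| ≤ C := le_of_ae_le
    ((h.continuous_iteratedDeriv_two.div (h.continuous.sub continuous_const) hne).abs) hb
  refine ⟨√C, fun x => ?_⟩
  have hlim : Tendsto (fun y => Up - U y) atTop (𝓝 0) := by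
    simpa using h.tendsto_top.const_sub Up
  have := neg_deriv_le_of_tendsto_zero (C := C) (fun x => (h.hasDerivAt x).const_sub Up)
    (fun x => (h.hasDerivAt_deriv x).neg) (fun x => (sub_pos.mpr (h.lt_top x)).le)
    (fun x => by simpa using (h.deriv_pos x).le) (fun y => ?_) hlim x
  · simpa using this
  · have h3 := hb' y
    rw [abs_div, div_le_iff₀ (abs_pos.mpr (hne y)), abs_of_neg (sub_neg.mpr (h.lt_top y)),
      neg_sub] at h3
    exact (neg_le_abs _).trans h3

/-- `U'` is bounded by a multiple of the distance of `U` to its limit at `-∞`. -/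
theorem exists_deriv_le_bot (h2 : H2 U Um Up) : ∃ K, ∀ x, deriv U x ≤ K * (U x - Um) := by
  obtain ⟨C, hC, hb⟩ := exists_abs_bound_of_memLp_top h2.quot_minus_bounded
  have hpos : ∀ y, 0 < U y - Um := fun y => sub_pos.mpr (h.bot_lt y)
  have hb' : ∀ y, |iteratedDeriv 2 U y / (U y - Um)| ≤ C := le_of_ae_le
    ((h.continuous_iteratedDeriv_two.div (h.continuous.sub continuous_const)
      fun y => (hpos y).ne').abs) hb
  refine ⟨√C, fun x => ?_⟩
  have hlim : Tendsto (fun y => U (-y) - Um) atTop (𝓝 0) := by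
    simpa using (h.tendsto_bot.comp tendsto_neg_atTop_atBot).sub_const Um
  have hd : ∀ x, HasDerivAt (fun y => U (-y) - Um) (-deriv U (-x)) x := fun x => by
    simpa using! ((h.hasDerivAt (-x)).scomp x (hasDerivAt_neg x)).sub_const Um
  have hd' : ∀ x, HasDerivAt (fun y => -deriv U (-y)) (iteratedDeriv 2 U (-x)) x := fun x => by
    simpa using! ((h.hasDerivAt_deriv (-x)).scomp x (hasDerivAt_neg x)).neg
  have := neg_deriv_le_of_tendsto_zero (C := C) hd hd' (fun x => (hpos _).le)
    (fun x => by simpa using (h.deriv_pos (-x)).le) (fun y => ?_) hlim (-x)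
  · simpa using this
  · have h3 := hb' (-y)
    rw [abs_div, div_le_iff₀ (abs_pos.mpr (hpos _).ne'), abs_of_pos (hpos _)] at h3
    exact (le_abs_self _).trans h3

end H1

namespace H1

variable {U : ℝ → ℝ} {Um Up : ℝ} (h : H1 U Um Up)
include h

/-- The logarithmic derivative of `U - c` is bounded near `+∞`, even if `c` is the limit of `U`. -/
theorem exists_eventually_log_deriv_le_top (h2 : H2 U Um Up) {c : ℝ} (hc : c ≤ Up) :
    ∃ M : ℝ, ∀ᶠ x in atTop, |deriv U x / (U x - c)| ≤ M := by
  obtain ⟨K, hK⟩ := h.exists_deriv_le_top h2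
  rcases hc.eq_or_lt with rfl | hlt
  · refine ⟨K, Eventually.of_forall fun x => ?_⟩
    have hx := h.lt_top x
    rw [abs_div, abs_of_pos (h.deriv_pos x), abs_of_neg (by linarith), div_le_iff₀ (by linarith)]
    linarith [hK x]
  · have h0 : Tendsto (deriv U) atTop (𝓝 0) := by
      refine squeeze_zero (fun x => (h.deriv_pos x).le) hK ?_
      simpa using (h.tendsto_top.const_sub Up).const_mul K
    have h3 := (h0.div (h.tendsto_top.sub_const c) (sub_pos.mpr hlt).ne').abs
    rw [zero_div, abs_zero] at h3
    exact ⟨1, h3.eventually_le_const one_pos⟩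

/-- The logarithmic derivative of `U - c` is bounded near `-∞`, even if `c` is the limit of `U`. -/
theorem exists_eventually_log_deriv_le_bot (h2 : H2 U Um Up) {c : ℝ} (hc : Um ≤ c) :
    ∃ M : ℝ, ∀ᶠ x in atBot, |deriv U x / (U x - c)| ≤ M := by
  obtain ⟨K, hK⟩ := h.exists_deriv_le_bot h2
  rcases hc.eq_or_lt with rfl | hlt
  · refine ⟨K, Eventually.of_forall fun x => ?_⟩
    have hx := h.bot_lt x
    rw [abs_div, abs_of_pos (h.deriv_pos x), abs_of_pos (by linarith), div_le_iff₀ (by linarith)]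
    linarith [hK x]
  · have h0 : Tendsto (deriv U) atBot (𝓝 0) := by
      refine squeeze_zero (fun x => (h.deriv_pos x).le) hK ?_
      simpa using (h.tendsto_bot.sub_const Um).const_mul K
    have h3 := (h0.div (h.tendsto_bot.sub_const c) (sub_neg.mpr hlt).ne).abs
    rw [zero_div, abs_zero] at h3
    exact ⟨1, h3.eventually_le_const one_pos⟩

/-- The Rayleigh equation `(U - c) (φ'' - A φ) = U'' φ` has no nonzero solution that vanishes at
infinity with its derivative and, if there is one, at the critical point `U = c`. -/
theorem rayleigh_unique (h2 : H2 U Um Up) {c : ℝ} (hc : c ∈ Set.Icc Um Up) {A : ℝ} (hA : 0 < A)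
    {φ φ' : ℝ → ℝ} (hφ : ∀ x, HasDerivAt φ (φ' x) x) (hφ'c : Continuous φ')
    (hφ0 : Tendsto φ (cocompact ℝ) (𝓝 0)) (hφ'0 : Tendsto φ' (cocompact ℝ) (𝓝 0))
    (hφ' : ∀ x, U x ≠ c →
      HasDerivAt φ' (iteratedDeriv 2 U x / (U x - c) * φ x + A * φ x) x)
    (hcrit : ∀ y, U y = c → φ y = 0) {x : ℝ} (hx : U x ≠ c) : φ x = 0 := by
  have hv : ∀ x, HasDerivAt (fun y => U y - c) (deriv U x) x := fun x =>
    (h.hasDerivAt x).sub_const c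
  have hinf : ∀ l : Filter ℝ, l ≤ cocompact ℝ →
      (∃ M : ℝ, ∀ᶠ x in l, |deriv U x / (U x - c)| ≤ M) →
      Tendsto (fun x => φ x * φ' x - deriv U x / (U x - c) * φ x ^ 2) l (𝓝 0) := by
    rintro l hl ⟨M, hM⟩
    have hsq : Tendsto (fun x => φ x ^ 2) l (𝓝 0) := by simpa using (hφ0.mono_left hl).pow 2
    simpa using ((hφ0.mono_left hl).mul (hφ'0.mono_left hl)).sub
      (bdd_le_mul_tendsto_zero' M hM hsq)
  have htop := hinf atTop atTop_le_cocompact (h.exists_eventually_log_deriv_le_top h2 hc.2)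
  have hbot := hinf atBot atBot_le_cocompact (h.exists_eventually_log_deriv_le_bot h2 hc.1)
  by_cases hex : ∃ z, U z = c
  · obtain ⟨z, rfl⟩ := hex
    have hz := hcrit z rfl
    have hne : ∀ y, y ≠ z → U y ≠ U z := fun y hy e => hy (h.strictMono.injective e)
    -- near the critical point `φ / (U - c)` stays bounded
    have hcr : Tendsto (fun x => φ x * φ' x - deriv U x / (U x - U z) * φ x ^ 2)
        (𝓝[≠] z) (𝓝 0) := by
      have hs := (hasDerivAt_iff_tendsto_slope.mp (hφ z)).div
        (hasDerivAt_iff_tendsto_slope.mp (h.hasDerivAt z)) (h.deriv_pos z).ne'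
      have hcφ : Tendsto φ (𝓝[≠] z) (𝓝 0) := by
        simpa [hz] using (hφ z).continuousAt.tendsto.mono_left nhdsWithin_le_nhds
      have hcφ' := (hφ'c.tendsto z).mono_left (nhdsWithin_le_nhds (s := {z}ᶜ))
      have hcU := (h.continuous_deriv.tendsto z).mono_left (nhdsWithin_le_nhds (s := {z}ᶜ))
      have ht := (hcφ.mul hcφ').sub ((hcU.mul hcφ).mul hs)
      rw [zero_mul, mul_zero, zero_mul, sub_zero] at ht
      refine ht.congr' ?_
      filter_upwards [self_mem_nhdsWithin] with y hy
      have h3 : y - z ≠ 0 := sub_ne_zero.mpr hy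
      have h4 : U y - U z ≠ 0 := sub_ne_zero.mpr (hne y hy)
      simp only [Pi.div_apply, slope_def_field, hz, sub_zero]
      field_simp
    have hxz : x ≠ z := fun e => hx (e ▸ rfl)
    rcases hxz.lt_or_gt with hlt | hgt
    · refine rayleigh_eq_zero (I := Set.Iio z) (l₁ := atBot) (l₂ := 𝓝[<] z) isOpen_Iio
        (convex_Iio z) (fun y hy => ?_) (fun y hy => ?_) hA hv h.hasDerivAt_deriv
        (fun y hy => sub_ne_zero.mpr (hne y (ne_of_lt hy))) hφ
        (fun y hy => hφ' y (hne y (ne_of_lt hy)))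
        hbot (hcr.mono_left (nhdsWithin_mono z fun y hy => ne_of_lt hy)) x hlt
      · filter_upwards [eventually_lt_atBot z, eventually_le_atBot y] with w h1 h2 using ⟨h1, h2⟩
      · filter_upwards [Ioo_mem_nhdsLT hy] with w hw using ⟨hw.2, hw.1.le⟩
    · refine rayleigh_eq_zero (I := Set.Ioi z) (l₁ := 𝓝[>] z) (l₂ := atTop) isOpen_Ioi
        (convex_Ioi z) (fun y hy => ?_) (fun y hy => ?_) hA hv h.hasDerivAt_deriv
        (fun y hy => sub_ne_zero.mpr (hne y (ne_of_gt hy))) hφ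
        (fun y hy => hφ' y (hne y (ne_of_gt hy)))
        (hcr.mono_left (nhdsWithin_mono z fun y hy => ne_of_gt hy)) htop x hgt
      · filter_upwards [Ioo_mem_nhdsGT hy] with w hw using ⟨hw.1, hw.2.le⟩
      · filter_upwards [eventually_gt_atTop z, eventually_ge_atTop y] with w h1 h2 using ⟨h1, h2⟩
  · push Not at hex
    refine rayleigh_eq_zero (I := Set.univ) (l₁ := atBot) (l₂ := atTop) isOpen_univ convex_univ
      (fun y _ => ?_) (fun y _ => ?_) hA hv h.hasDerivAt_deriv
      (fun y _ => sub_ne_zero.mpr (hex y)) hφ (fun y _ => hφ' y (hex y)) hbot htop x trivial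
    · filter_upwards [eventually_le_atBot y] with w h2 using ⟨trivial, h2⟩
    · filter_upwards [eventually_ge_atTop y] with w h2 using ⟨trivial, h2⟩

/-- If `g` is square integrable and `(U - c) g = m φ` with `φ` continuous, then `φ` vanishes at the
critical point `U = c`: otherwise `g` would have a nonintegrable singularity there. -/
theorem eq_zero_of_critical {g : L2} {φ : ℝ → ℂ} (hφ : Continuous φ) {z : ℝ} (hz : U z ≠ 0)
    (hg : ∀ᵐ y, ((U y - U z : ℝ) : ℂ) * g y = m U y * φ y) : φ z = 0 := by
  by_contra hne
  set G : ℝ → ℂ := fun y => m U y * φ y / ((U y - U z : ℝ) : ℂ)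
  have hG : (g : ℝ → ℂ) =ᵐ[volume] G := by
    filter_upwards [hg, h.ae_ne (U z)] with y hy hn
    have : ((U y - U z : ℝ) : ℂ) ≠ 0 := by exact_mod_cast sub_ne_zero.mpr hn
    simp only [G]
    rw [← hy]
    field_simp
  have hint : IntervalIntegrable G volume z (z + 1) := by
    have hgi : IntervalIntegrable g volume z (z + 1) :=
      intervalIntegrable_coeFn g _ _
    exact hgi.congr_ae (ae_restrict_of_ae hG)
  refine not_intervalIntegrable_of_sub_inv_isBigO_punctured (c := z) ?_ (by linarith)
    Set.left_mem_uIcc hint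
  -- the product of `y - z` and `G y` has a nonzero limit at `z`
  have hm : Tendsto (m U) (𝓝 z) (𝓝 (m U z)) := by
    have hq : Tendsto (fun y => iteratedDeriv 2 U y / U y) (𝓝 z) (𝓝 (quotU U z)) := by
      rw [h.quotU_eq hz]
      exact (h.continuous_iteratedDeriv_two.tendsto z).div (h.continuous.tendsto z) hz
    refine (Real.continuous_sqrt.tendsto _).comp (hq.congr' ?_).neg
    filter_upwards [h.continuous.continuousAt.eventually_ne hz] with y hy
    exact (h.quotU_eq hy).symm
  have hs := hasDerivAt_iff_tendsto_slope.mp (h.hasDerivAt z)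
  have hlim : Tendsto (fun y => ((slope U z y : ℝ) : ℂ)⁻¹ * (m U y * φ y)) (𝓝[≠] z)
      (𝓝 (((deriv U z : ℝ) : ℂ)⁻¹ * (m U z * φ z))) := by
    have hc : Tendsto (fun y => (m U y : ℂ) * φ y) (𝓝[≠] z) (𝓝 (m U z * φ z)) :=
      (((Complex.continuous_ofReal.tendsto _).comp hm).mul (hφ.tendsto z)).mono_left
        nhdsWithin_le_nhds
    refine (((Complex.continuous_ofReal.tendsto _).comp hs).inv₀ ?_).mul hc
    exact_mod_cast (h.deriv_pos z).ne'
  have hlim0 : ((deriv U z : ℝ) : ℂ)⁻¹ * (m U z * φ z) ≠ 0 := by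
    have h3 : ((deriv U z : ℝ) : ℂ) ≠ 0 := by exact_mod_cast (h.deriv_pos z).ne'
    have h4 : (m U z : ℂ) ≠ 0 := by exact_mod_cast (h.m_pos z).ne'
    exact mul_ne_zero (inv_ne_zero h3) (mul_ne_zero h4 hne)
  have hO : (fun _ => (1 : ℝ)) =O[𝓝[≠] z] fun y => ((slope U z y : ℝ) : ℂ)⁻¹ * (m U y * φ y) := by
    rw [Asymptotics.isBigO_const_left_iff_pos_le_norm one_ne_zero]
    refine ⟨_, half_pos (norm_pos_iff.mpr hlim0), ?_⟩
    exact hlim.norm.eventually_const_le (half_lt_self (norm_pos_iff.mpr hlim0))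
  have hinv : (fun y => (y - z)⁻¹) =O[𝓝[≠] z] fun y => ((y - z : ℝ) : ℂ)⁻¹ :=
    Asymptotics.isBigO_of_le _ fun y => by rw [norm_inv, norm_inv, Complex.norm_real]
  refine (hO.mul hinv).congr' (Eventually.of_forall fun y => one_mul _) ?_
  filter_upwards [self_mem_nhdsWithin] with y hy
  have h3 : (y : ℂ) - z ≠ 0 := by exact_mod_cast sub_ne_zero.mpr hy
  have h4 : (U y : ℂ) - U z ≠ 0 := by
    exact_mod_cast sub_ne_zero.mpr fun e => hy (h.strictMono.injective e)
  simp only [slope_def_field, G]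
  push_cast
  field_simp

end H1

/-! ### The operator `Σ` and its square root -/

section PosSqrt

variable {E : Type*} [NormedAddCommGroup E] [InnerProductSpace ℂ E] [CompleteSpace E]

theorem posSqrt_isSelfAdjoint (T : E →L[ℂ] E) : IsSelfAdjoint (posSqrt T) :=
  IsSelfAdjoint.of_nonneg (CFC.sqrt_nonneg T)

theorem posSqrt_mul_self {T : E →L[ℂ] E} (hT : 0 ≤ T) : posSqrt T * posSqrt T = T :=
  CFC.sqrt_mul_sqrt_self _ hT

theorem isUnit_posSqrt {T : E →L[ℂ] E} (hT : 0 ≤ T) (hu : IsUnit T) : IsUnit (posSqrt T) :=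
  (CFC.isUnit_sqrt_iff _ hT).mpr hu

end PosSqrt

section Sigma

variable {U : ℝ → ℝ} {α : ℤ}

theorem opSigma_eq_one_sub (hα : α ≠ 0) :
    opSigma U α = 1 - birmanSchwinger (m U) ((α : ℝ) ^ 2) := by
  rw [opSigma, invLaplacian_eq_neg hα, birmanSchwinger]
  noncomm_ring

theorem H3.mem_resolventSet (h3 : H3 U) {t : ℝ} (ht : 1 ≤ t) :
    ((-t : ℝ) : ℂ) ∈ resolventSet (schrodinger fun y => -(m U y) ^ 2) := by
  obtain ⟨lam, hglb, hlam⟩ := h3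
  by_contra hn
  have := hglb.1 (show -t ∈ {x : ℝ | (x : ℂ) ∈ _} from hn)
  linarith

theorem isUnit_opSigma (hm : EssBounded (m U)) (h3 : H3 U) (hα : α ≠ 0) :
    IsUnit (opSigma U α) := by
  rw [opSigma_eq_one_sub hα]
  exact isUnit_one_sub_birmanSchwinger hm (one_le_sq hα) (h3.mem_resolventSet (one_le_sq hα))

theorem opSigma_nonneg (hm : EssBounded (m U)) (h3 : H3 U) (hα : α ≠ 0) : 0 ≤ opSigma U α := by
  rw [opSigma_eq_one_sub hα, sub_nonneg,
    ← CStarAlgebra.norm_le_one_iff_of_nonneg _ (birmanSchwinger_nonneg hm (one_le_sq hα))]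
  exact (norm_birmanSchwinger_lt_one hm (one_le_sq hα) fun t ht => h3.mem_resolventSet ht).le

theorem opSigma_le_one (hm : EssBounded (m U)) (hα : α ≠ 0) : opSigma U α ≤ 1 := by
  rw [opSigma_eq_one_sub hα, sub_le_self_iff]
  exact birmanSchwinger_nonneg hm (one_le_sq hα)

theorem opS_isSelfAdjoint : IsSelfAdjoint (opS U α) :=
  posSqrt_isSelfAdjoint _

theorem opS_mul_self (hm : EssBounded (m U)) (h3 : H3 U) (hα : α ≠ 0) :
    opS U α * opS U α = opSigma U α :=
  posSqrt_mul_self (opSigma_nonneg hm h3 hα)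

theorem isUnit_opS (hm : EssBounded (m U)) (h3 : H3 U) (hα : α ≠ 0) : IsUnit (opS U α) :=
  isUnit_posSqrt (opSigma_nonneg hm h3 hα) (isUnit_opSigma hm h3 hα)

end Sigma

/-! ### Absence of eigenvalues -/

/-- If `Σ U g = c g` with `c` in the range `[U₋, U₊]`, then `φ = (-∂_y² + α²)⁻¹ (m U g)` solves the
Rayleigh equation and `(U - c) g = m φ`; hence `φ = 0` and `g = 0`. -/
theorem eq_zero_of_opSigma_mulOp_eq {U : ℝ → ℝ} {Um Up : ℝ} (h1 : H1 U Um Up) (h2 : H2 U Um Up)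
    {α : ℤ} (hα : α ≠ 0) (hinj : Function.Injective (opSigma U α)) {c : ℝ}
    (hc : c ∈ Set.Icc Um Up) {g : L2} (hg : opSigma U α (mulOp U g) = (c : ℂ) • g) : g = 0 := by
  have hUg := mulOp_coeFn h1.essBounded g
  rcases eq_or_ne c 0 with rfl | hc0
  · rw [Complex.ofReal_zero, zero_smul, ← map_zero (opSigma U α)] at hg
    have h0 := hinj hg
    rw [h0] at hUg
    apply Lp.ext
    filter_upwards [hUg, h1.ae_ne 0, Lp.coeFn_zero ℂ 2 (volume : Measure ℝ)] with y e hy e0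
    rw [e0, Pi.zero_apply] at e ⊢
    have hy' : (U y : ℂ) ≠ 0 := by exact_mod_cast hy
    simpa [hy'] using e.symm
  set s : ℝ := (α : ℝ) ^ 2 with hs_def
  have hs : 1 ≤ s := one_le_sq hα
  set F : L2 := mulOp (m U) (mulOp U g) with hF_def
  obtain ⟨_, -, hreg⟩ := exists_regular_resolventLaplacian hs
  obtain ⟨φ, φ', hRφ, hφ, hφ'c, hφ0, hφ'0, -, hint⟩ := hreg F
  have hcont : Continuous φ := continuous_iff_continuousAt.mpr fun x => (hφ x).continuousAt
  have hF : ∀ᵐ y, F y = m U y * (U y * g y) := by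
    filter_upwards [mulOp_coeFn h1.essBounded_m (mulOp U g), hUg] with y e1 e2
    rw [e1, e2]
  have hmφ : ∀ᵐ y, ((U y - c : ℝ) : ℂ) * g y = m U y * φ y := by
    have e : mulOp U g - mulOp (m U) (resolventLaplacian s F) = (c : ℂ) • g := by
      rw [← hg, opSigma_eq_one_sub hα]; rfl
    have e' := congrArg (fun f : L2 => (f : ℝ → ℂ)) e
    filter_upwards [Lp.coeFn_sub (mulOp U g) (mulOp (m U) (resolventLaplacian s F)),
      Lp.coeFn_smul (c : ℂ) g, hUg, mulOp_coeFn h1.essBounded_m (resolventLaplacian s F), hRφ]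
      with y k1 k2 k3 k4 k5
    have k := congrFun e' y
    beta_reduce at k
    rw [k1, k2, Pi.sub_apply, k3, k4, k5, Pi.smul_apply, smul_eq_mul] at k
    push_cast
    linear_combination k
  have hcrit : ∀ z, U z = c → φ z = 0 := by
    rintro z rfl
    exact h1.eq_zero_of_critical hcont hc0 hmφ
  set k : ℝ → ℂ := fun y => ((iteratedDeriv 2 U y / (U y - c) : ℝ) : ℂ) * φ y + s * φ y
  -- the equation `φ'' = s φ - F` is the Rayleigh equation, as
  -- `F = m² U φ / (U - c) = -U'' φ / (U - c)`
  have hk : (fun y => s * φ y - F y) =ᵐ[volume] k := by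
    filter_upwards [hF, hmφ, h1.ae_ne 0, h1.ae_ne c] with y e1 e2 n0 nc
    have hm2 : ((m U y : ℝ) : ℂ) ^ 2 = -(iteratedDeriv 2 U y / U y) := by
      exact_mod_cast congrArg Complex.ofReal (h1.m_sq n0)
    have nc' : (U y : ℂ) - c ≠ 0 := by exact_mod_cast sub_ne_zero.mpr nc
    have n0' : (U y : ℂ) ≠ 0 := by exact_mod_cast n0
    have e3 : g y = m U y * φ y / (U y - c) := by
      rw [← e2]; push_cast; field_simp
    have e4 : F y = (m U y : ℂ) ^ 2 * U y * φ y / (U y - c) := by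
      rw [e1, e3]; ring
    simp only [k]
    rw [e4, hm2]
    push_cast
    field_simp
    ring
  have hki : ∀ a b, IntervalIntegrable k volume a b := by
    intro a b
    have h3 : IntervalIntegrable (fun y => s * φ y - F y) volume a b :=
      ((hcont.const_mul (s : ℂ)).intervalIntegrable a b).sub
        (intervalIntegrable_coeFn F a b)
    exact h3.congr_ae (ae_restrict_of_ae hk)
  have hφ' : ∀ x, U x ≠ c → HasDerivAt φ' (k x) x := by
    intro x hx
    have hkc : ContinuousAt k x := by
      refine ((Complex.continuous_ofReal.continuousAt.comp
        (h1.continuous_iteratedDeriv_two.continuousAt.div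
          (h1.continuous.sub continuous_const).continuousAt (sub_ne_zero.mpr hx))).mul
          hcont.continuousAt).add (hcont.const_mul (s : ℂ)).continuousAt
    have hmeas : AEStronglyMeasurable k volume :=
      ((hcont.const_mul (s : ℂ)).aestronglyMeasurable.sub (Lp.aestronglyMeasurable F)).congr hk
    have h3 := (intervalIntegral.integral_hasDerivAt_right (hki (x - 1) x)
      hmeas.stronglyMeasurableAtFilter hkc).const_add (φ' (x - 1))
    refine h3.congr_of_eventuallyEq ?_
    filter_upwards [eventually_ge_nhds (show x - 1 < x by linarith)] with y hy
    rw [← intervalIntegral.integral_congr_ae (hk.mono fun _ e _ => e), ← hint _ _ hy]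
    ring
  have hs0 : 0 < s := by linarith
  have hzero : ∀ x, U x ≠ c → φ x = 0 := by
    intro x hx
    apply Complex.ext
    · refine h1.rayleigh_unique h2 hc hs0 (φ := fun y => (φ y).re) (φ' := fun y => (φ' y).re)
        (fun y => Complex.reCLM.hasFDerivAt.comp_hasDerivAt y (hφ y))
        (Complex.continuous_re.comp hφ'c)
        ((Complex.continuous_re.tendsto 0).comp hφ0) ((Complex.continuous_re.tendsto 0).comp hφ'0)
        (fun y hy => ?_) (fun y hy => by simp [hcrit y hy]) hx
      have h4 := Complex.reCLM.hasFDerivAt.comp_hasDerivAt y (hφ' y hy)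
      simpa only [k, Complex.reCLM_apply, Complex.add_re, Complex.re_ofReal_mul] using! h4
    · refine h1.rayleigh_unique h2 hc hs0 (φ := fun y => (φ y).im) (φ' := fun y => (φ' y).im)
        (fun y => Complex.imCLM.hasFDerivAt.comp_hasDerivAt y (hφ y))
        (Complex.continuous_im.comp hφ'c)
        ((Complex.continuous_im.tendsto 0).comp hφ0) ((Complex.continuous_im.tendsto 0).comp hφ'0)
        (fun y hy => ?_) (fun y hy => by simp [hcrit y hy]) hx
      have h4 := Complex.imCLM.hasFDerivAt.comp_hasDerivAt y (hφ' y hy)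
      simpa only [k, Complex.imCLM_apply, Complex.add_im, Complex.im_ofReal_mul] using! h4
  apply Lp.ext
  filter_upwards [hmφ, h1.ae_ne c, Lp.coeFn_zero ℂ 2 (volume : Measure ℝ)] with y e nc e0
  rw [hzero y nc, mul_zero] at e
  have nc' : ((U y - c : ℝ) : ℂ) ≠ 0 := by exact_mod_cast sub_ne_zero.mpr nc
  rw [e0, Pi.zero_apply]
  exact (mul_eq_zero.mp e).resolve_left nc'

/-! ### The spectrum -/

theorem spectrum_subset_of_le {E : Type*} [NormedAddCommGroup E] [InnerProductSpace ℂ E]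
    [CompleteSpace E] {T : E →L[ℂ] E} (hT : IsSelfAdjoint T) {a b : ℝ}
    (ha : algebraMap ℝ (E →L[ℂ] E) a ≤ T) (hb : T ≤ algebraMap ℝ (E →L[ℂ] E) b) :
    spectrum ℂ T ⊆ (fun x : ℝ => (x : ℂ)) '' Set.Icc a b := by
  intro z hz
  have hre := hT.mem_spectrum_eq_re hz
  have hmem : z.re ∈ spectrum ℝ T := by
    rw [← spectrum.algebraMap_mem_iff ℂ, Complex.coe_algebraMap, ← hre]
    exact hz
  exact ⟨z.re, ⟨(algebraMap_le_iff_le_spectrum hT).mp ha _ hmem,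
    (le_algebraMap_iff_spectrum_le hT).mp hb _ hmem⟩, hre.symm⟩

section Conjugate

variable {E : Type*} [NormedAddCommGroup E] [InnerProductSpace ℂ E] [CompleteSpace E]
  {S T : E →L[ℂ] E}

theorem conjugate_le_algebraMap (hS : IsSelfAdjoint S) (hle : S * S ≤ 1) {b : ℝ} (hb : 0 ≤ b)
    (hT : T ≤ algebraMap ℝ (E →L[ℂ] E) b) : S * T * S ≤ algebraMap ℝ (E →L[ℂ] E) b := by
  refine (hS.conjugate_le_conjugate hT).trans ?_
  rw [Algebra.algebraMap_eq_smul_one, mul_smul_comm, mul_one, smul_mul_assoc]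
  exact smul_le_smul_of_nonneg_left hle hb

theorem algebraMap_le_conjugate (hS : IsSelfAdjoint S) (hle : S * S ≤ 1) {a : ℝ} (ha : a ≤ 0)
    (hT : algebraMap ℝ (E →L[ℂ] E) a ≤ T) : algebraMap ℝ (E →L[ℂ] E) a ≤ S * T * S := by
  have h := conjugate_le_algebraMap hS hle (T := -T) (neg_nonneg.mpr ha)
    (by rw [map_neg]; exact neg_le_neg hT)
  rw [map_neg, mul_neg, neg_mul] at h
  exact neg_le_neg_iff.mp h

end Conjugate

/-- `(-∂_y² + s)⁻¹` extends to a bounded operator from `L¹` to `L²`, by duality with the bound from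
`L²` to `L^∞`. -/
theorem exists_norm_resolventLaplacian_le_integral {s : ℝ} (hs : 1 ≤ s) :
    ∃ K : ℝ, 0 ≤ K ∧ ∀ G : L2, Integrable G → ‖resolventLaplacian s G‖ ≤ K * ∫ x, ‖G x‖ := by
  obtain ⟨K, hK, hreg⟩ := exists_regular_resolventLaplacian hs
  refine ⟨K, hK, fun G hG => ?_⟩
  set R := resolventLaplacian s
  obtain ⟨φ, -, hφ, -, -, -, -, hb, -⟩ := hreg (R G)
  have hsymm := (ContinuousLinearMap.isSelfAdjoint_iff_isSymmetric.mp
    (fourierMul_isSelfAdjoint (resolventSymbol_essBounded hs))) G (R G)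
  simp only [ContinuousLinearMap.coe_coe] at hsymm
  have h1 : ‖R G‖ * ‖R G‖ ≤ (K * ∫ x, ‖G x‖) * ‖R G‖ := by
    rw [← inner_self_eq_norm_mul_norm (𝕜 := ℂ)]
    refine (RCLike.re_le_norm _).trans ?_
    rw [hsymm, L2.inner_def]
    refine (norm_integral_le_of_norm_le (hG.norm.const_mul (K * ‖R G‖)) ?_).trans_eq ?_
    · filter_upwards [hφ] with x hx
      refine (norm_inner_le_norm _ _).trans ?_
      rw [hx, mul_comm]
      exact mul_le_mul_of_nonneg_right (hb x) (norm_nonneg _)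
    · rw [integral_const_mul]; ring
  rcases (norm_nonneg (R G)).eq_or_lt with h0 | h0
  · rw [← h0]
    positivity
  · exact le_of_mul_le_mul_right h1 h0

section Spectrum

variable {U : ℝ → ℝ} {Um Up : ℝ} {α : ℤ}

theorem opH_isSelfAdjoint (h1 : H1 U Um Up) : IsSelfAdjoint (opH U α) := by
  have hS : IsSelfAdjoint (opS U α) := opS_isSelfAdjoint
  have hU := mulOp_isSelfAdjoint h1.essBounded
  rw [IsSelfAdjoint, opH, star_mul, star_mul, hS.star_eq, hU.star_eq, mul_assoc]

/-- Since `0 ≤ Σ ≤ 1` and `U₋ < 0 < U₊`, the bounds `U₋ ≤ U ≤ U₊` pass to `H`. -/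
theorem spectrum_opH_subset (h1 : H1 U Um Up) (h3 : H3 U) (hα : α ≠ 0) :
    spectrum ℂ (opH U α) ⊆ (fun x : ℝ => (x : ℂ)) '' Set.Icc Um Up := by
  have hm := h1.essBounded_m
  have hS : IsSelfAdjoint (opS U α) := opS_isSelfAdjoint
  have hle : opS U α * opS U α ≤ 1 := opS_mul_self hm h3 hα ▸ opSigma_le_one hm hα
  refine spectrum_subset_of_le (opH_isSelfAdjoint h1) ?_ ?_
  · refine algebraMap_le_conjugate hS hle h1.bot_neg.le ?_
    exact (mulOp_const Um).ge.trans <| mulOp_mono (essBounded_const Um) h1.essBounded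
      fun y => (h1.bot_lt y).le
  · refine conjugate_le_algebraMap hS hle h1.top_pos.le ?_
    exact (mulOp_mono h1.essBounded (essBounded_const Up) fun y => (h1.lt_top y).le).trans
      (mulOp_const Up).le

/-- The values of `U` are in the spectrum of `H`, which is similar to
`Σ U = U - m (-∂_y² + α²)⁻¹ m U`: the indicator functions `f` of shrinking intervals at a point `z`
are approximate eigenvectors of `U`, and `m (-∂_y² + α²)⁻¹ m U f` is negligible because the `L¹`
norm of `f` is small compared to its `L²` norm. -/
theorem mem_spectrum_opH (h1 : H1 U Um Up) (h3 : H3 U) (hα : α ≠ 0) (z : ℝ) :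
    ((U z : ℝ) : ℂ) ∈ spectrum ℂ (opH U α) := by
  have hm := h1.essBounded_m
  rw [spectrum.mem_iff]
  intro hu
  -- `T = U z - Σ U` is conjugate to `U z - H` by `S`, so it would be bounded below
  set T : L2 →L[ℂ] L2 := algebraMap ℂ _ ((U z : ℝ) : ℂ) - opSigma U α * mulOp U
  have hTS : T * opS U α = opS U α * (algebraMap ℂ _ ((U z : ℝ) : ℂ) - opH U α) := by
    rw [sub_mul, mul_sub, ← Algebra.commutes, ← opS_mul_self hm h3 hα, opH]
    simp only [mul_assoc]
  obtain ⟨S', hS'⟩ := isUnit_opS hm h3 hα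
  have hT : IsUnit T := by
    have h4 : T = opS U α * (algebraMap ℂ _ ((U z : ℝ) : ℂ) - opH U α) * ↑S'⁻¹ := by
      rw [← hTS, ← hS', mul_assoc, Units.mul_inv, mul_one]
    rw [h4]
    exact ((isUnit_opS hm h3 hα).mul hu).mul (Units.isUnit _)
  obtain ⟨T', hT'⟩ := hT
  set K₀ := ‖(↑T'⁻¹ : L2 →L[ℂ] L2)‖
  have hbelow : ∀ f : L2, ‖f‖ ≤ K₀ * ‖T f‖ := fun f => by
    have h5 : (↑T'⁻¹ : L2 →L[ℂ] L2) (T f) = f := by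
      rw [← hT', ← mul_apply_eq_comp, Units.inv_mul, one_apply_eq_self]
    nth_rw 1 [← h5]
    exact ContinuousLinearMap.le_opNorm _ _
  obtain ⟨K, hK, hL1⟩ := exists_norm_resolventLaplacian_le_integral (one_le_sq hα)
  obtain ⟨M, hM, hMb⟩ := (hm.mul h1.essBounded).exists_bound
  set C := ‖mulOp (m U)‖ * (K * M)
  have hC : 0 ≤ C := by positivity
  have hK₀ : 0 ≤ K₀ := norm_nonneg _
  -- `ε` is the size allowed for `|U - U z|` and for `C √δ`
  set ε : ℝ := (4 * (K₀ + 1))⁻¹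
  have hε : 0 < ε := by positivity
  obtain ⟨δ₀, hδ₀, hU⟩ := Metric.continuous_iff.mp h1.continuous z ε hε
  set δ : ℝ := min (δ₀ / 2) ((ε / (C + 1)) ^ 2)
  have hδ : 0 < δ := by positivity
  have hδC : C * √δ ≤ ε := by
    have h6 : √δ ≤ ε / (C + 1) := by
      rw [← Real.sqrt_sq (show 0 ≤ ε / (C + 1) by positivity)]
      exact Real.sqrt_le_sqrt (min_le_right _ _)
    calc C * √δ ≤ (C + 1) * (ε / (C + 1)) := by gcongr; linarith
      _ = ε := by field_simp
  have hfin : volume (Set.Ioc z (z + δ)) ≠ (⊤ : ℝ≥0∞) := by simp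
  set f : L2 := indicatorConstLp 2 measurableSet_Ioc hfin (1 : ℂ)
  have hf : f =ᵐ[volume] (Set.Ioc z (z + δ)).indicator fun _ => (1 : ℂ) := indicatorConstLp_coeFn
  have hfn : ‖f‖ = √δ := by
    rw [norm_indicatorConstLp (by simp) (by simp), norm_one, one_mul, Real.volume_real_Ioc,
      Real.sqrt_eq_rpow]
    simp [hδ.le]
  have hG : ∀ᵐ y, (mulOp (m U) (mulOp U f)) y = ((m U y * U y : ℝ) : ℂ) * f y := by
    filter_upwards [mulOp_coeFn hm (mulOp U f), mulOp_coeFn h1.essBounded f] with y e1 e2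
    rw [e1, e2]; push_cast; ring
  have hGb : ∀ᵐ y, ‖(mulOp (m U) (mulOp U f)) y‖ ≤
      M * (Set.Ioc z (z + δ)).indicator (fun _ => (1 : ℝ)) y := by
    filter_upwards [hG, hMb, hf] with y e1 e2 e3
    rw [e1, norm_mul, Complex.norm_real, e3, norm_indicator_eq_indicator_norm]
    simp only [norm_one]
    exact mul_le_mul_of_nonneg_right e2 (Set.indicator_nonneg (fun _ _ => zero_le_one) _)
  have hind : Integrable fun y => M * (Set.Ioc z (z + δ)).indicator (fun _ => (1 : ℝ)) y :=
    ((integrable_indicator_iff measurableSet_Ioc).mpr (integrableOn_const hfin)).const_mul M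
  have hGi : Integrable (mulOp (m U) (mulOp U f)) :=
    hind.mono' (Lp.aestronglyMeasurable _) hGb
  have hGn : ∫ y, ‖(mulOp (m U) (mulOp U f)) y‖ ≤ M * δ := by
    refine (integral_mono_ae hGi.norm hind hGb).trans_eq ?_
    rw [integral_const_mul, integral_indicator measurableSet_Ioc]
    simp [hδ.le]
  have hTf : T f = ((U z : ℂ) • f - mulOp U f) +
      mulOp (m U) (resolventLaplacian ((α : ℝ) ^ 2) (mulOp (m U) (mulOp U f))) := by
    have e : T f = (U z : ℂ) • f - (mulOp U f -
        mulOp (m U) (resolventLaplacian ((α : ℝ) ^ 2) (mulOp (m U) (mulOp U f)))) := by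
      simp only [T, opSigma_eq_one_sub hα, Algebra.algebraMap_eq_smul_one]
      rfl
    rw [e]; abel
  have hn1 : ‖(U z : ℂ) • f - mulOp U f‖ ≤ ε * √δ := by
    rw [← hfn]
    refine Lp.norm_le_mul_norm_of_ae_le_mul ?_
    filter_upwards [Lp.coeFn_sub ((U z : ℂ) • f) (mulOp U f), Lp.coeFn_smul (U z : ℂ) f,
      mulOp_coeFn h1.essBounded f, hf] with y e1 e2 e3 e4
    rw [e1, Pi.sub_apply, e2, Pi.smul_apply, e3, smul_eq_mul, ← sub_mul, norm_mul]
    by_cases hy : y ∈ Set.Ioc z (z + δ)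
    · refine mul_le_mul_of_nonneg_right ?_ (norm_nonneg _)
      have h7 : dist y z < δ₀ := by
        rw [Real.dist_eq, abs_of_pos (by linarith [hy.1])]
        have : δ ≤ δ₀ / 2 := min_le_left _ _
        linarith [hy.2]
      have h8 := (hU y h7).le
      rw [dist_comm, Real.dist_eq] at h8
      rwa [← Complex.ofReal_sub, Complex.norm_real]
    · rw [e4, Set.indicator_of_notMem hy, norm_zero, mul_zero, mul_zero]
  have hn2 : ‖mulOp (m U) (resolventLaplacian ((α : ℝ) ^ 2) (mulOp (m U) (mulOp U f)))‖ ≤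
      ε * √δ := by
    calc _ ≤ ‖mulOp (m U)‖ * ‖resolventLaplacian ((α : ℝ) ^ 2) (mulOp (m U) (mulOp U f))‖ :=
          ContinuousLinearMap.le_opNorm _ _
      _ ≤ ‖mulOp (m U)‖ * (K * (M * δ)) := by
          gcongr
          exact (hL1 _ hGi).trans (by gcongr)
      _ = C * √δ * √δ := by rw [mul_assoc, Real.mul_self_sqrt hδ.le]; ring
      _ ≤ ε * √δ := by gcongr
  have hfinal := hbelow f
  have hs : 0 < √δ := Real.sqrt_pos.mpr hδ
  have h9 : ‖T f‖ ≤ 2 * ε * √δ := by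
    rw [hTf]
    linarith [norm_add_le ((U z : ℂ) • f - mulOp U f)
      (mulOp (m U) (resolventLaplacian ((α : ℝ) ^ 2) (mulOp (m U) (mulOp U f))))]
  have h10 : K₀ * (2 * ε) < 1 := by
    simp only [ε]
    rw [← mul_assoc, mul_inv_lt_iff₀ (by positivity)]
    linarith
  have h11 : √δ ≤ K₀ * (2 * ε) * √δ := by
    rw [hfn] at hfinal
    calc √δ ≤ K₀ * ‖T f‖ := hfinal
      _ ≤ K₀ * (2 * ε * √δ) := by gcongr
      _ = _ := by ring
  nlinarith

theorem spectrum_opH (h1 : H1 U Um Up) (h3 : H3 U) (hα : α ≠ 0) :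
    spectrum ℂ (opH U α) = (fun x : ℝ => (x : ℂ)) '' Set.Icc Um Up := by
  refine (spectrum_opH_subset h1 h3 hα).antisymm ?_
  have hlt : Um < Up := h1.bot_neg.trans h1.top_pos
  rw [← closure_Ioo hlt.ne]
  refine (image_closure_subset_closure_image Complex.continuous_ofReal).trans
    (closure_minimal ?_ (spectrum.isClosed _))
  rintro _ ⟨x, hx, rfl⟩
  obtain ⟨z, rfl⟩ := mem_range_of_exists_le_of_exists_ge h1.continuous
    ((h1.tendsto_bot.eventually_le_const hx.1).exists)
    ((h1.tendsto_top.eventually_const_le hx.2).exists)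
  exact mem_spectrum_opH h1 h3 hα z

theorem opH_not_hasEigenvalue (h1 : H1 U Um Up) (h2 : H2 U Um Up) (h3 : H3 U) (hα : α ≠ 0)
    (c : ℂ) :
    ¬ Module.End.HasEigenvalue (opH U α : L2 →ₗ[ℂ] L2) c := by
  intro hc
  obtain ⟨f, hf⟩ := hc.exists_hasEigenvector
  have hHf : opH U α f = c • f := hf.apply_eq_smul
  have hm := h1.essBounded_m
  have hspec : c ∈ spectrum ℂ (opH U α) := by
    rw [spectrum.mem_iff]
    intro hu
    obtain ⟨V, hV⟩ := hu
    apply hf.2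
    have h4 : (algebraMap ℂ (L2 →L[ℂ] L2) c - opH U α) f = 0 := by
      rw [Algebra.algebraMap_eq_smul_one, sub_apply, hHf]
      exact sub_self _
    rw [← one_apply_eq_self (F := L2 →L[ℂ] L2) f, ← V.inv_mul, mul_apply_eq_comp, hV, h4, map_zero]
  obtain ⟨x, hx, rfl⟩ := spectrum_opH_subset h1 h3 hα hspec
  have hinj : ∀ {A : L2 →L[ℂ] L2}, IsUnit A → Function.Injective A := by
    rintro _ ⟨V, rfl⟩ a b hab
    have := congrArg (↑V⁻¹ : L2 →L[ℂ] L2) hab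
    rwa [← mul_apply_eq_comp, ← mul_apply_eq_comp, V.inv_mul, one_apply_eq_self,
      one_apply_eq_self] at this
  have hg : opSigma U α (mulOp U (opS U α f)) = (x : ℂ) • opS U α f := by
    rw [← map_smul, ← hHf, ← opS_mul_self hm h3 hα]
    rfl
  have h0 := eq_zero_of_opSigma_mulOp_eq h1 h2 hα (hinj (isUnit_opSigma hm h3 hα)) hx hg
  exact hf.2 (hinj (isUnit_opS hm h3 hα) (h0.trans (map_zero _).symm))

end Spectrum

end MixingLayer

theorem mainTheorem6 (U : ℝ → ℝ) (Um Up : ℝ) (h1 : MixingLayer.H1 U Um Up)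
    (h2 : MixingLayer.H2 U Um Up) (h3 : MixingLayer.H3 U) (α : ℤ) (hα : α ≠ 0) :
    spectrum ℂ (MixingLayer.opH U α) = (fun x : ℝ => (x : ℂ)) '' Set.Icc Um Up ∧
      ∀ c : ℂ, ¬ Module.End.HasEigenvalue
        (MixingLayer.opH U α : MixingLayer.L2 →ₗ[ℂ] MixingLayer.L2) c := by
  exact ⟨MixingLayer.spectrum_opH h1 h3 hα, MixingLayer.opH_not_hasEigenvalue h1 h2 h3 hα⟩
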